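/- Let $X$ be a finite quandle (written $x*y$, with $x\mapsto x*y$ bijective, $x*x=x$ and $(x*y)*z=(x*z)*(y*z)$), let $a\in X$, let $S\subset\mathrm{End}(X)$ be any set of quandle endomorphisms, let $A$ be an abelian group and let $\theta:X^3\to A$ be a quandle $3$-cocycle, i.e. $\theta(x,x,y)=\theta(x,y,y)=0$ and $$\theta(x,y,z)+\theta(x*z,y*z,w)+\theta(x,z,w)=\theta(x*y,z,w)+\theta(x,y,w)+\theta(x*w,y*w,z*w)$$ for all $x,y,z,w\in X$. For an oriented link diagram $D$ in $\mathbb R^2$, with underlying immersed curves $|D|$, a shadow $X$-coloring $c_*$ assigns an element of $X$ to every arc of $D$ and to every region (connected component of $\mathbb R^2\setminus|D|$) such that (i) at every crossing $c_*(x_i)*c_*(x_j)=c_*(x_k)$, where $x_j$ is the over-arc and $x_i$, $x_k$ are the under-arcs on the right and on the left of $x_j$, and (ii) $c_*(r_1)*c_*(\alpha)=c_*(r_2)$ whenever the regions $r_1$ and $r_2$ are adjacent along the arc $\alpha$, with $r_1$ on its right and $r_2$ on its left. Let $\mathrm{SCol}_X(D,a)$ be the set of shadow $X$-colorings for which the unbounded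 region has color $a$. The weight $\Phi_\theta(D,c_*)\in A$ is the sum over all crossings of $\varepsilon\,\theta(x,y,z)$, where $\varepsilon=\pm1$ is the sign of the crossing, $z$ is the color of the over-arc, $y$ is the color of the under-arc on the right of the over-arc, and $x$ is the color of the region near the crossing that lies on the right of both strands. The shadow quandle cocycle quiver $SQ^{S,\theta}_X(D,a)$ is the quiver with vertex set $\mathrm{SCol}_X(D,a)$ and with one edge from $v_*$ to $w_*$ for each $f\in S$ such that $w_*=f\circ v_*$ on the arcs of $D$, together with the weight function $\rho:\mathrm{SCol}_X(D,a)\to A$, $\rho(c_*)=\Phi_\theta(D,c_*)$. **Proposition.** If two oriented link diagrams $D$ and $D'$ in the plane are related by a finite sequence of Reidemeister moves (and planar isotopies), then for all $X,a,S,A,\theta$ as above the shadow quandle cocycle quivers $SQ^{S,\theta}_X(D,a)$ and $SQ^{S,\theta}_X(D',a)$ are isomorphic: there is a bijection $\varphi:\mathrm{SCol}_X(D,a)\to\mathrm{SCol}_X(D',a)$ which is part of an isomorphism of quivers (for all $v_*,w_*$ the edges from $v_*$ to $w_*$ correspond bijectively to the edges from $\varphi(v_*)$ to $\varphi(w_*)$)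 and which preserves the weights, $\rho(c_*)=\rho'(\varphi(c_*))$ for every $c_*\in\mathrm{SCol}_X(D,a)$. -/

import Mathlib

open Filter Topology

/-! ### Oriented link diagrams in the plane

The plane `ℝ²` is `ℂ`.  Diagrams are polygonal.  The vertices of the polygons include all the
crossing points: a crossing point is the position of exactly two vertices, one on the over-strand
and one on the under-strand.  All the other vertices are ordinary vertices of the polygons, and
vertices at which the polygon does not bend are allowed. -/

/-- The determinant of two plane vectors; it is positive when `w` points to the left of `z`. -/
def planeDet (z w : ℂ) : ℝ := z.re * w.im - z.im * w.re

/-- An oriented link diagram in the plane: finitely many oriented closed polygons, in general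
position, with over/under information at the double points. The edge that starts at the vertex `v`
is the segment from `pos v` to `pos (next v)` and is also denoted by `v`. -/
structure LinkDiagram where
  /-- The vertices of the polygons (equivalently, their oriented edges). -/
  V : Type
  finite_V : Finite V
  /-- The vertex that follows a given vertex along the orientation. -/
  next : Equiv.Perm V
  pos : V → ℂ
  /-- The vertices that are the over-passages of crossings. -/
  overSet : Set V
  pos_next_ne : ∀ v, pos (next v) ≠ pos v
  vertex_not_mem_edge : ∀ v w, pos v ∉ openSegment ℝ (pos w) (pos (next w))
  edges_disjoint : ∀ v w, v ≠ w →
    Disjoint (openSegment ℝ (pos v) (pos (next v))) (openSegment ℝ (pos w) (pos (next w)))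
  no_triple_point : ∀ u v w, pos u = pos v → pos v = pos w → u = v ∨ v = w ∨ u = w
  /-- Both strands are straight at a crossing point ... -/
  straight : ∀ v w, v ≠ w → pos v = pos w →
    pos v ∈ openSegment ℝ (pos (next.symm v)) (pos (next v))
  /-- ... and cross each other transversally. -/
  transverse : ∀ v w, v ≠ w → pos v = pos w →
    planeDet (pos (next v) - pos v) (pos (next w) - pos w) ≠ 0
  /-- At a crossing point exactly one of the two strands is the over-strand. -/
  over_iff : ∀ v w, v ≠ w → pos v = pos w → (v ∈ overSet ↔ w ∉ overSet)
  exists_of_over : ∀ v ∈ overSet, ∃ w, v ≠ w ∧ pos v = pos w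

namespace LinkDiagram

instance (D : LinkDiagram) : Finite D.V := D.finite_V

/-- The direction vector of the edge `v`. -/
def dir (D : LinkDiagram) (v : D.V) : ℂ := D.pos (D.next v) - D.pos v

/-- The edge that precedes the edge `v` (it ends at the vertex `v`). -/
def prev (D : LinkDiagram) (v : D.V) : D.V := D.next.symm v

/-- The closed segment that is the edge `v`. -/
noncomputable def edge (D : LinkDiagram) (v : D.V) : Set ℂ := segment ℝ (D.pos v) (D.pos (D.next v))

/-- The underlying immersed curves `|D|`. -/
noncomputable def curve (D : LinkDiagram) : Set ℂ := ⋃ v, D.edge v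

/-! ### Crossings and arcs -/

/-- The strands through the vertices `o` and `u` cross there, and `o` is the over-passage. -/
def IsCrossing (D : LinkDiagram) (o u : D.V) : Prop := o ≠ u ∧ D.pos o = D.pos u ∧ o ∈ D.overSet

/-- A crossing `(o, u)` is positive if the under-strand passes from the right of the over-strand
to its left. -/
def IsPositive (D : LinkDiagram) (o u : D.V) : Prop := 0 < planeDet (D.dir o) (D.dir u)

/-- `(o, u)` is a crossing, positive if `b = true` and negative if `b = false`. -/
def IsSignedCrossing (D : LinkDiagram) (o u : D.V) (b : Bool) : Prop :=
  D.IsCrossing o u ∧ (D.IsPositive o u ↔ b = true)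

/-- The crossings of the diagram. -/
def Crossing (D : LinkDiagram) : Type := {χ : D.V × D.V // D.IsCrossing χ.1 χ.2}

instance (D : LinkDiagram) : Finite D.Crossing := by unfold Crossing; infer_instance

noncomputable instance (D : LinkDiagram) : Fintype D.Crossing := Fintype.ofFinite _

/-- Two consecutive edges belong to the same arc unless the strand passes under another strand at
the vertex between them. The arcs of `D` are the classes of edges for the generated equivalence. -/
def Arc (D : LinkDiagram) : Type :=
  Quot fun v w : D.V => w = D.next v ∧ ¬ ∃ o, D.IsCrossing o w

/-- The arc that contains the edge `v`. -/
def arc (D : LinkDiagram) (v : D.V) : D.Arc := Quot.mk _ v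

namespace Crossing

variable {D : LinkDiagram}

/-- The over-arc at a crossing. -/
def overArc (χ : D.Crossing) : D.Arc := D.arc χ.1.1

open Classical in
/-- The under-edge at a crossing that lies on the right of the over-strand. -/
noncomputable def rightUnder (χ : D.Crossing) : D.V :=
  if D.IsPositive χ.1.1 χ.1.2 then D.prev χ.1.2 else χ.1.2

open Classical in
/-- The under-edge at a crossing that lies on the left of the over-strand. -/
noncomputable def leftUnder (χ : D.Crossing) : D.V :=
  if D.IsPositive χ.1.1 χ.1.2 then χ.1.2 else D.prev χ.1.2

open Classical in
/-- The sign of a crossing. -/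
noncomputable def sign (χ : D.Crossing) : ℤ :=
  if D.IsPositive χ.1.1 χ.1.2 then 1 else -1

end Crossing

/-! ### Regions -/

/-- The regions of `D`: the connected components of `ℝ² \ |D|`. -/
def Region (D : LinkDiagram) : Type := ConnectedComponents ↥(D.curve)ᶜ

/-- The region of a point of `ℝ² \ |D|`. -/
noncomputable def regionOf (D : LinkDiagram) (z : ℂ) (hz : z ∈ (D.curve)ᶜ) : D.Region :=
  ConnectedComponents.mk (⟨z, hz⟩ : ↥(D.curve)ᶜ)

/-- The set of points of a region. -/
def Region.points {D : LinkDiagram} (r : D.Region) : Set ℂ := {z | ∃ hz, D.regionOf z hz = r}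

theorem regionOf_eq_of_isPreconnected (D : LinkDiagram) {s : Set ℂ} (hs : IsPreconnected s)
    (hsD : s ⊆ (D.curve)ᶜ) {z w : ℂ} (hz : z ∈ s) (hw : w ∈ s) :
    D.regionOf z (hsD hz) = D.regionOf w (hsD hw) := by
  have h1 : IsPreconnected ((Subtype.val : ↥(D.curve)ᶜ → ℂ) ⁻¹' s) := by
    rw [← Topology.IsInducing.subtypeVal.isPreconnected_image,
      Subtype.image_preimage_coe, Set.inter_eq_right.2 hsD]
    exact hs
  exact ConnectedComponents.coe_eq_coe'.2
    (h1.subset_connectedComponent (x := ⟨w, hsD hw⟩) hw hz)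

theorem isCompact_edge (D : LinkDiagram) (v : D.V) : IsCompact (D.edge v) := by
  unfold edge
  rw [segment_eq_image]
  exact isCompact_Icc.image (by fun_prop)

theorem isCompact_curve (D : LinkDiagram) : IsCompact D.curve :=
  isCompact_iUnion D.isCompact_edge

theorem exists_unique_unbounded (D : LinkDiagram) :
    ∃! r : D.Region, ¬ Bornology.IsBounded r.points := by
  obtain ⟨R, hR⟩ := D.isCompact_curve.isBounded.subset_closedBall (0 : ℂ)
  set R' := max R 0 with hR'
  have hR0 : 0 ≤ R' := le_max_right _ _
  set s : Set ℂ := {z | R' < ‖z‖} with hs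
  have hsD : s ⊆ (D.curve)ᶜ := by
    intro z hz hzD
    have := hR hzD
    rw [mem_closedBall_zero_iff] at this
    exact absurd (lt_of_le_of_lt (le_max_left R 0) hz) (not_lt.2 this)
  have hconn : IsPreconnected s := by
    have : s = (fun p : ℝ × ℝ => (p.1 : ℂ) * Complex.exp (p.2 * Complex.I)) ''
        (Set.Ioi R' ×ˢ Set.univ) := by
      ext z
      constructor
      · intro hz
        exact ⟨(‖z‖, z.arg), ⟨hz, trivial⟩, Complex.norm_mul_exp_arg_mul_I z⟩
      · rintro ⟨⟨a, b⟩, ⟨ha, -⟩, rfl⟩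
        have ha' : R' < a := ha
        simp only [hs, Set.mem_ofPred_eq, norm_mul, Complex.norm_exp_ofReal_mul_I, mul_one,
          Complex.norm_real, Real.norm_eq_abs]
        exact ha'.trans_le (le_abs_self a)
    rw [this]
    exact (isPreconnected_Ioi.prod isPreconnected_univ).image _ (by fun_prop)
  have hmem : ((R' + 1 : ℝ) : ℂ) ∈ s := by
    simp only [hs, Set.mem_ofPred_eq, Complex.norm_real, Real.norm_eq_abs]
    rw [abs_of_nonneg (by linarith)]
    linarith
  refine ⟨D.regionOf _ (hsD hmem), ?_, ?_⟩
  · intro hb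
    have hsub : s ⊆ (D.regionOf _ (hsD hmem)).points := fun z hz =>
      ⟨hsD hz, D.regionOf_eq_of_isPreconnected hconn hsD hz hmem⟩
    obtain ⟨C, hC⟩ := (hb.subset hsub).subset_closedBall (0 : ℂ)
    have hz : ((max R' C + 1 : ℝ) : ℂ) ∈ s := by
      simp only [hs, Set.mem_ofPred_eq, Complex.norm_real, Real.norm_eq_abs]
      have := le_max_left R' C
      rw [abs_of_nonneg (by linarith)]
      linarith
    have h2 := hC hz
    rw [mem_closedBall_zero_iff, Complex.norm_real, Real.norm_eq_abs] at h2
    have h3 := le_abs_self (max R' C + 1)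
    have h4 := le_max_right R' C
    linarith
  · intro r hr
    have : ∃ z ∈ r.points, R' < ‖z‖ := by
      by_contra hcon
      push Not at hcon
      exact hr (Metric.isBounded_closedBall.subset
        (fun z hz => mem_closedBall_zero_iff.2 (hcon z hz)))
    obtain ⟨z, ⟨hz1, hz2⟩, hz⟩ := this
    rw [← hz2]
    exact D.regionOf_eq_of_isPreconnected hconn hsD hz hmem

/-- The unbounded region `r_∞`. -/
noncomputable def outer (D : LinkDiagram) : D.Region := D.exists_unique_unbounded.choose

/-- The midpoint of the edge `v`. -/
noncomputable def mid (D : LinkDiagram) (v : D.V) : ℂ := D.pos v + (1 / 2 : ℝ) • D.dir v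

/-- A normal vector of the edge `v`, pointing to the left (`b = true`) or to the right
(`b = false`). -/
noncomputable def normal (D : LinkDiagram) (v : D.V) (b : Bool) : ℂ :=
  (if b then Complex.I else -Complex.I) * D.dir v

theorem mid_mem_openSegment (D : LinkDiagram) (v : D.V) :
    D.mid v ∈ openSegment ℝ (D.pos v) (D.pos (D.next v)) := by
  refine ⟨1 / 2, 1 / 2, by norm_num, by norm_num, by norm_num, ?_⟩
  simp only [mid, dir, Complex.real_smul]
  push_cast
  ring

theorem exists_side_region (D : LinkDiagram) (v : D.V) (b : Bool) :
    ∃ r : D.Region, ∀ᶠ ε : ℝ in 𝓝[>] 0, D.mid v + ε • D.normal v b ∈ r.points := by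
  have hd : D.dir v ≠ 0 := sub_ne_zero.2 (D.pos_next_ne v)
  set n := D.normal v b with hn
  have hK : IsClosed (⋃ w : {w : D.V // w ≠ v}, D.edge w) :=
    (isCompact_iUnion fun w : {w : D.V // w ≠ v} => D.isCompact_edge w).isClosed
  have hmid : D.mid v ∈ (⋃ w : {w : D.V // w ≠ v}, D.edge w)ᶜ := by
    rw [Set.mem_compl_iff, Set.mem_iUnion]
    rintro ⟨⟨w, hw⟩, hm⟩
    simp only [edge] at hm
    rw [← insert_endpoints_openSegment] at hm
    rcases hm with h | h | h
    · exact D.vertex_not_mem_edge w v (h ▸ D.mid_mem_openSegment v)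
    · exact D.vertex_not_mem_edge (D.next w) v (h ▸ D.mid_mem_openSegment v)
    · exact Set.disjoint_left.1 (D.edges_disjoint v w hw.symm) (D.mid_mem_openSegment v) h
  have hcont : Continuous fun ε : ℝ => D.mid v + ε • n := by fun_prop
  have hnhds : ∀ᶠ ε : ℝ in 𝓝 0,
      D.mid v + ε • n ∈ (⋃ w : {w : D.V // w ≠ v}, D.edge w)ᶜ := by
    refine hcont.continuousAt.eventually_mem (hK.isOpen_compl.mem_nhds ?_)
    simpa using hmid
  obtain ⟨δ, hδ, hball⟩ := Metric.eventually_nhds_iff.1 hnhds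
  have hown : ∀ ε : ℝ, 0 < ε → D.mid v + ε • n ∉ D.edge v := by
    intro ε hε hmem
    simp only [edge] at hmem
    rw [segment_eq_image'] at hmem
    obtain ⟨t, -, ht⟩ := hmem
    have h1 : ((t - 1 / 2 : ℝ) : ℂ) * D.dir v =
        ((ε : ℂ) * (if b then Complex.I else -Complex.I)) * D.dir v := by
      simp only [mid, hn, normal, Complex.real_smul] at ht
      have : D.pos (D.next v) - D.pos v = D.dir v := rfl
      rw [this] at ht
      push_cast at ht ⊢
      linear_combination ht
    have h2 := congrArg Complex.im (mul_right_cancel₀ hd h1)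
    cases b <;> simp at h2 <;> linarith
  set s : Set ℂ := (fun ε : ℝ => D.mid v + ε • n) '' Set.Ioo 0 δ with hs
  have hconn : IsPreconnected s := isPreconnected_Ioo.image _ hcont.continuousOn
  have hsD : s ⊆ (D.curve)ᶜ := by
    rintro _ ⟨ε, hε, rfl⟩ hmem
    obtain ⟨w, hw⟩ := Set.mem_iUnion.1 hmem
    by_cases hwv : w = v
    · subst hwv
      exact hown ε hε.1 hw
    · refine hball (y := ε) ?_ (Set.mem_iUnion.2 ⟨⟨w, hwv⟩, hw⟩)
      rw [Real.dist_eq, sub_zero, abs_of_pos hε.1]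
      exact hε.2
  have hmem : D.mid v + (δ / 2) • n ∈ s := ⟨δ / 2, ⟨by linarith, by linarith⟩, rfl⟩
  refine ⟨D.regionOf _ (hsD hmem), ?_⟩
  filter_upwards [Ioo_mem_nhdsGT hδ] with ε hε
  exact ⟨hsD ⟨ε, hε, rfl⟩, D.regionOf_eq_of_isPreconnected hconn hsD ⟨ε, hε, rfl⟩ hmem⟩

/-- The region adjacent to the edge `v` on its left (`b = true`) or on its right (`b = false`). -/
noncomputable def side (D : LinkDiagram) (v : D.V) (b : Bool) : D.Region :=
  (D.exists_side_region v b).choose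

end LinkDiagram

/-! ### Shadow colorings

Mathlib writes the quandle operation on the left: `x ∗ y` is `Shelf.act y x`. -/

/-- The quandle operation `x ∗ y`. -/
def quandleOp {X : Type*} [Quandle X] (x y : X) : X := Shelf.act y x

section

local infixl:70 " ∗ " => quandleOp

/-- Quandle `3`-cocycles with values in an abelian group. -/
structure IsQuandleThreeCocycle {X A : Type*} [Quandle X] [AddCommGroup A] (θ : X → X → X → A) :
    Prop where
  left_degenerate : ∀ x y, θ x x y = 0
  right_degenerate : ∀ x y, θ x y y = 0
  cocycle : ∀ x y z w, θ x y z + θ (x ∗ z) (y ∗ z) w + θ x z w =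
    θ (x ∗ y) z w + θ x y w + θ (x ∗ w) (y ∗ w) (z ∗ w)

/-- The shadow `X`-colorings of `D` in which the unbounded region has the color `a`. -/
@[ext]
structure ShadowColoring (D : LinkDiagram) (X : Type*) [Quandle X] (a : X) where
  onArc : D.Arc → X
  onRegion : D.Region → X
  /-- The coloring condition at every crossing. -/
  crossing_rule : ∀ χ : D.Crossing,
    onArc (D.arc χ.rightUnder) ∗ onArc χ.overArc = onArc (D.arc χ.leftUnder)
  /-- The condition for two regions adjacent along an arc (the second region is on the left). -/
  region_rule : ∀ v : D.V,
    onRegion (D.side v false) ∗ onArc (D.arc v) = onRegion (D.side v true)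
  outer_color : onRegion D.outer = a

end

/-- The weight `Φ_θ(D, c)`: the sum over the crossings of `± θ(x, y, z)`, where `z` is the color of
the over-arc, `y` is the color of the under-arc on the right of the over-arc, and `x` is the color
of the region near the crossing on the right of both strands. -/
noncomputable def ShadowColoring.weight {D : LinkDiagram} {X A : Type*} [Quandle X]
    [AddCommGroup A] {a : X} (θ : X → X → X → A) (c : ShadowColoring D X a) : A :=
  ∑ χ : D.Crossing, χ.sign •
    θ (c.onRegion (D.side χ.rightUnder false)) (c.onArc (D.arc χ.rightUnder)) (c.onArc χ.overArc)

/-! ### The shadow quandle cocycle quiver -/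

/-- The vertices of the shadow quandle coloring quiver `SQ^S_X(D, a)`. -/
def ShadowQuiver (D : LinkDiagram) {X : Type*} [Quandle X] (_S : Set (ShelfHom X X)) (a : X) :
    Type _ := ShadowColoring D X a

/-- In `SQ^S_X(D, a)` there is one edge from `v` to `w` for each `f ∈ S` such that `w = f ∘ v` on
the arcs of `D`. -/
instance (D : LinkDiagram) {X : Type*} [Quandle X] (S : Set (ShelfHom X X)) (a : X) :
    Quiver (ShadowQuiver D S a) where
  Hom v w := {f : ShelfHom X X // f ∈ S ∧
    ∀ α : D.Arc, ShadowColoring.onArc w α = f.toFun (ShadowColoring.onArc v α)}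

/-- The weight function `ρ` of the shadow quandle cocycle quiver `SQ^{S,θ}_X(D, a)`. -/
noncomputable def ShadowQuiver.rho {D : LinkDiagram} {X A : Type*} [Quandle X] [AddCommGroup A]
    {S : Set (ShelfHom X X)} {a : X} (θ : X → X → X → A) (c : ShadowQuiver D S a) : A :=
  ShadowColoring.weight θ c

/-- An isomorphism of quivers (bijections on the vertices and on the edges) that preserves given
weights of the vertices. -/
structure WeightedQuiverIso {Q Q' A : Type*} [Quiver Q] [Quiver Q'] (ρ : Q → A) (ρ' : Q' → A) where
  onVertex : Q ≃ Q'
  onEdge : ∀ v w : Q, (v ⟶ w) ≃ (onVertex v ⟶ onVertex w)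
  weight_eq : ∀ v, ρ v = ρ' (onVertex v)

/-! ### Reidemeister moves

Moves are described up to planar isotopy, by recording what happens to edges, crossings and
regions.  In each move the edges of the two diagrams are matched by a bijection `φ` that preserves
the orientation of the strands; the edges that lie inside the disk where the move takes place are
named, all the crossings and all the adjacencies of edges and regions outside the disk are
unchanged, and the picture inside the disk is described completely.  Enough non-crossing vertices
for this can be put on the strands by `Subdivision`. -/

namespace LinkDiagram

/-- The vertex `v` is not a crossing point. -/
def IsMark (D : LinkDiagram) (v : D.V) : Prop := ∀ w, v ≠ w → D.pos v ≠ D.pos w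

/-- Planar isotopy: an orientation-preserving homeomorphism of the plane that maps one diagram to
the other induces bijections `φ` of the edges and `ψ` of the regions that preserve the order of the
edges, the crossings with their signs, the regions on the two sides of each edge and the unbounded
region; conversely, such a pair `(φ, ψ)` always comes from such a homeomorphism. -/
def PlanarIsotopic (D D' : LinkDiagram) : Prop :=
  ∃ (φ : D.V ≃ D'.V) (ψ : D.Region ≃ D'.Region),
    (∀ v, φ (D.next v) = D'.next (φ v)) ∧
    (∀ o u b, D'.IsSignedCrossing (φ o) (φ u) b ↔ D.IsSignedCrossing o u b) ∧
    (∀ v b, D'.side (φ v) b = ψ (D.side v b)) ∧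
    ψ D.outer = D'.outer

/-- `D'` is obtained from `D` (up to planar isotopy) by putting a new vertex `m` on the edge `e`
of `D`, which becomes the two edges `ι e` and `m`. -/
def Subdivision (D D' : LinkDiagram) : Prop :=
  ∃ (ι : D.V → D'.V) (m : D'.V) (e : D.V) (ψ : D.Region ≃ D'.Region),
    Function.Injective ι ∧ (∀ v', v' ≠ m ↔ v' ∈ Set.range ι) ∧
    D'.next (ι e) = m ∧ D'.next m = ι (D.next e) ∧
    (∀ v, v ≠ e → D'.next (ι v) = ι (D.next v)) ∧
    D'.IsMark m ∧
    (∀ o u b, D'.IsSignedCrossing (ι o) (ι u) b ↔ D.IsSignedCrossing o u b) ∧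
    (∀ v b, D'.side (ι v) b = ψ (D.side v b)) ∧
    (∀ b, D'.side m b = ψ (D.side e b)) ∧
    ψ D.outer = D'.outer

/-- First Reidemeister move, creating a kink. The path `p₀ p₁ p₂` of three edges becomes a loop
around a new region `m` that lies on its left (`s = true`) or on its right (`s = false`).
At the new crossing the beginning (`f = true`) or the end (`f = false`) of the loop is over. -/
def ReidemeisterOne (D D' : LinkDiagram) : Prop :=
  ∃ (φ : D.V ≃ D'.V) (ψ : D.Region → D'.Region) (p₀ p₁ p₂ p₃ : D.V) (s f : Bool) (m : D'.Region),
    (∀ v, φ (D.next v) = D'.next (φ v)) ∧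
    p₁ = D.next p₀ ∧ p₂ = D.next p₁ ∧ p₃ = D.next p₂ ∧
    -- regions: exactly one new region
    Function.Injective ψ ∧ (∀ r', r' ≠ m ↔ r' ∈ Set.range ψ) ∧ ψ D.outer = D'.outer ∧
    -- crossings: exactly one new crossing
    D.IsMark p₀ ∧ D.IsMark p₁ ∧ D.IsMark p₂ ∧ D.IsMark p₃ ∧
    (∀ o u b, D'.IsSignedCrossing (φ o) (φ u) b ↔ D.IsSignedCrossing o u b ∨
      (o = (if f then p₀ else p₃) ∧ u = (if f then p₃ else p₀) ∧ b = (s != f))) ∧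
    -- the edges outside the disk
    (∀ v, v ≠ p₀ → v ≠ p₁ → v ≠ p₂ → ∀ b, D'.side (φ v) b = ψ (D.side v b)) ∧
    -- the picture before the move
    (∃ P Q : D.Region, ∀ v, (v = D.prev p₀ ∨ v = p₀ ∨ v = p₁ ∨ v = p₂ ∨ v = p₃) →
      D.side v s = P ∧ D.side v (!s) = Q) ∧
    -- the picture after the move
    (∃ P Q : D'.Region,
      (∀ v, (v = p₀ ∨ v = p₁ ∨ v = p₂) → D'.side (φ v) s = m ∧ D'.side (φ v) (!s) = P) ∧
      (∀ v, (v = D.prev p₀ ∨ v = p₃) → D'.side (φ v) s = P ∧ D'.side (φ v) (!s) = Q))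

/-- Second Reidemeister move, creating two crossings. The disk contains the path `p₀ p₁` of two
edges of one strand and the path `q₀ q₁` of two edges of the other strand. In `D` these strands
are disjoint and have a region in common, which lies on the side `s` of the strand of `p₀` and on
the side `t` of the strand of `q₀` (`true` is left; the strands are parallel if `s ≠ t` and
antiparallel if `s = t`). In `D'` the strand of `p₀` passes over the other strand,
and the two paths bound a new region `m`. The map `π` from the regions of `D'` (other than `m`) to
those of `D` identifies the two regions at the ends of the disk, which are parts of
one region of `D`. -/
def ReidemeisterTwo (D D' : LinkDiagram) : Prop :=
  ∃ (φ : D.V ≃ D'.V) (π : D'.Region → D.Region) (p₀ p₁ p₂ q₀ q₁ q₂ : D.V) (s t : Bool)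
    (m M₁ M₂ : D'.Region),
    (∀ v, φ (D.next v) = D'.next (φ v)) ∧
    p₁ = D.next p₀ ∧ p₂ = D.next p₁ ∧ q₁ = D.next q₀ ∧ q₂ = D.next q₁ ∧
    -- regions
    (∀ r, ∃ r', r' ≠ m ∧ π r' = r) ∧
    (∀ r' r'', r' ≠ m → r'' ≠ m →
      (π r' = π r'' ↔ r' = r'' ∨ (r' = M₁ ∧ r'' = M₂) ∨ (r' = M₂ ∧ r'' = M₁))) ∧
    D'.outer ≠ m ∧ π D'.outer = D.outer ∧
    -- crossings: exactly two new crossings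
    D.IsMark p₀ ∧ D.IsMark p₁ ∧ D.IsMark p₂ ∧ D.IsMark q₀ ∧ D.IsMark q₁ ∧ D.IsMark q₂ ∧
    (∀ o u b, D'.IsSignedCrossing (φ o) (φ u) b ↔ D.IsSignedCrossing o u b ∨
      (o = p₀ ∧ u = (if s = t then q₂ else q₀) ∧ b = t) ∨
      (o = p₂ ∧ u = (if s = t then q₀ else q₂) ∧ b = !t)) ∧
    -- the edges outside the disk
    (∀ v, v ≠ p₀ → v ≠ p₁ → v ≠ q₀ → v ≠ q₁ → ∀ b,
      D'.side (φ v) b ≠ m ∧ π (D'.side (φ v) b) = D.side v b) ∧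
    -- the picture before the move
    (∃ P Q M : D.Region,
      (∀ v, (v = D.prev p₀ ∨ v = p₀ ∨ v = p₁ ∨ v = p₂) → D.side v s = M ∧ D.side v (!s) = P) ∧
      (∀ v, (v = D.prev q₀ ∨ v = q₀ ∨ v = q₁ ∨ v = q₂) → D.side v t = M ∧ D.side v (!t) = Q)) ∧
    -- the picture after the move
    (∃ P Q : D'.Region,
      (∀ v, (v = p₀ ∨ v = p₁) → D'.side (φ v) s = Q ∧ D'.side (φ v) (!s) = m) ∧
      (∀ v, (v = q₀ ∨ v = q₁) → D'.side (φ v) t = P ∧ D'.side (φ v) (!t) = m) ∧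
      (∀ v, v = D.prev p₀ → D'.side (φ v) s = M₁ ∧ D'.side (φ v) (!s) = P) ∧
      (∀ v, v = p₂ → D'.side (φ v) s = M₂ ∧ D'.side (φ v) (!s) = P) ∧
      (∀ v, v = (if s = t then q₂ else D.prev q₀) →
        D'.side (φ v) t = M₁ ∧ D'.side (φ v) (!t) = Q) ∧
      (∀ v, v = (if s = t then D.prev q₀ else q₂) →
        D'.side (φ v) t = M₂ ∧ D'.side (φ v) (!t) = Q))

/-- The first (`α = true`) or the second (`α = false`) end point of the edge `v`. -/
def endpoint (D : LinkDiagram) (v : D.V) (α : Bool) : D.V := if α then v else D.next v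

/-- The edge that is adjacent to `v` at the first (`α = true`) or second (`α = false`) end point
of `v`. -/
def neighbor (D : LinkDiagram) (v : D.V) (α : Bool) : D.V := if α then D.prev v else D.next v

/-- A triangular region `T` bounded by the edges `p` (of the top strand), `q` (of the middle
strand) and `r` (of the bottom strand). Its corners are the crossing `X` of `p` and `q`, the
crossing `Y` of `q` and `r`, and the crossing `Z` of `r` and `p`; they follow each other
counterclockwise if `o = true` and clockwise if `o = false`. The edge `p` starts at `X` if
`α = true` and at `Z` if `α = false`; `q` starts at `X` if `β = true` and at `Y` if `β = false`;
`r` starts at `Y` if `γ = true` and at `Z` if `γ = false`. The triangle lies on the side `sp` of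
`p`, `sq` of `q` and `sr` of `r`. Around the triangle there are the regions `Rp`, `Rq`, `Rr`
opposite to it along its sides and `RX`, `RY`, `RZ` opposite to it at its corners. -/
def TriangleAt (D : LinkDiagram) (p q r : D.V) (α β γ o : Bool) (T : D.Region) : Prop :=
  ∃ (sp sq sr : Bool) (Rp Rq Rr RX RY RZ : D.Region),
    sp = (o == !α) ∧ sq = (o == β) ∧ sr = (o == γ) ∧
    D.IsSignedCrossing (D.endpoint p α) (D.endpoint q β) (o == (sp == sq)) ∧
    D.IsSignedCrossing (D.endpoint q (!β)) (D.endpoint r γ) (o == (sq == sr)) ∧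
    D.IsSignedCrossing (D.endpoint p (!α)) (D.endpoint r (!γ)) (o != (sp == sr)) ∧
    -- the sides of the triangle
    D.side p sp = T ∧ D.side p (!sp) = Rp ∧
    D.side q sq = T ∧ D.side q (!sq) = Rq ∧
    D.side r sr = T ∧ D.side r (!sr) = Rr ∧
    -- the prolongations of `p` and `q` at `X`
    D.side (D.neighbor p α) sp = Rq ∧ D.side (D.neighbor p α) (!sp) = RX ∧
    D.side (D.neighbor q β) sq = Rp ∧ D.side (D.neighbor q β) (!sq) = RX ∧
    -- the prolongations of `q` and `r` at `Y`
    D.side (D.neighbor q (!β)) sq = Rr ∧ D.side (D.neighbor q (!β)) (!sq) = RY ∧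
    D.side (D.neighbor r γ) sr = Rq ∧ D.side (D.neighbor r γ) (!sr) = RY ∧
    -- the prolongations of `r` and `p` at `Z`
    D.side (D.neighbor r (!γ)) sr = Rp ∧ D.side (D.neighbor r (!γ)) (!sr) = RZ ∧
    D.side (D.neighbor p (!α)) sp = Rr ∧ D.side (D.neighbor p (!α)) (!sp) = RZ ∧
    -- the triangle is bounded by its three sides only
    T ≠ D.outer ∧ ∀ v, v ≠ p → v ≠ q → v ≠ r → ∀ b, D.side v b ≠ T

/-- Third Reidemeister move. On each of the three strands the two crossings are interchanged, and
the triangle appears on the other side of the strand. -/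
def ReidemeisterThree (D D' : LinkDiagram) : Prop :=
  ∃ (φ : D.V ≃ D'.V) (ψ : D.Region ≃ D'.Region) (p q r : D.V) (α β γ o : Bool) (T : D.Region),
    (∀ v, φ (D.next v) = D'.next (φ v)) ∧
    D.TriangleAt p q r α β γ o T ∧
    D'.TriangleAt (φ p) (φ q) (φ r) (!α) (!β) (!γ) o (ψ T) ∧
    -- the crossings outside the disk
    (∀ v, v ≠ p → v ≠ D.next p → v ≠ q → v ≠ D.next q → v ≠ r → v ≠ D.next r →
      ∀ u b, D'.IsSignedCrossing (φ v) (φ u) b ↔ D.IsSignedCrossing v u b) ∧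
    -- the edges outside the disk
    (∀ v, v ≠ p → v ≠ q → v ≠ r → ∀ b, D'.side (φ v) b = ψ (D.side v b)) ∧
    ψ D.outer = D'.outer

/-- One Reidemeister move or planar isotopy. -/
inductive Move : LinkDiagram → LinkDiagram → Prop
  | isotopy {D D' : LinkDiagram} : PlanarIsotopic D D' → Move D D'
  | subdivision {D D' : LinkDiagram} : Subdivision D D' → Move D D'
  | one {D D' : LinkDiagram} : ReidemeisterOne D D' → Move D D'
  | two {D D' : LinkDiagram} : ReidemeisterTwo D D' → Move D D'
  | three {D D' : LinkDiagram} : ReidemeisterThree D D' → Move D D'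

/-- Two diagrams are related by Reidemeister moves if they are connected by a finite sequence of
Reidemeister moves, planar isotopies and the inverses of these. -/
def RelatedByReidemeisterMoves (D D' : LinkDiagram) : Prop := Relation.EqvGen Move D D'

end LinkDiagram

/-! A move changes a diagram only inside a disk. Call shadow colorings before and after the move
related if they agree on the edges and regions that the move keeps and leaves free to be compared.
The three quandle axioms say that every coloring on one side of the move has a related coloring on
the other side, and that it is unique; this is the bijection $\varphi$. Idempotence serves a kink,
invertibility of the translations serves two strands sliding over each other, and
self-distributivity serves the triangle move. Self-distributivity also makes the color of a region
independent of the edge across which it is computed.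

The bijection respects the edges of the quivers for the following reason. If $w=f\circ v$ on arcs,
then $\varphi(w)$ and $f\circ\varphi(v)$ are arc colorings of $D'$ related to the same arc coloring
of $D$, hence equal; the converse is symmetric. Regions have to be left out here, since $f$ may move
the outer color $a$. This is why `ShadowEquivalent.of_relations` asks for uniqueness of arc
colorings by themselves, and of region colorings over a fixed arc coloring.

For the weights, crossings outside the disk keep their contributions. A kink contributes
$\pm\theta(x,y,y)=0$. The two crossings of the second move contribute the same value of $\theta$
with opposite signs. In the third move the three crossings before and the three after give the six
terms of the cocycle identity, evaluated at the region on the right of all three strands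
(`triangleWeight_eq`).

To avoid arcs as quotient classes, colorings are handled as functions on edges
(`shadowColoringEquiv`), and weights as sums over triples of over-vertex, under-vertex and sign
(`weight_eq_finsum`). The operation `signedOp`, indexed by a sign, treats all orientations of the
strands at once. -/

section SignedOperation

/-! ### The quandle operation and its inverse, with a sign. -/

variable {X : Type*} [Quandle X]

/-- The quandle operation `x ∗ y` (`b = true`) or its inverse `x ∗⁻¹ y` (`b = false`). -/
def signedOp (b : Bool) (x y : X) : X := if b then Shelf.act y x else Rack.invAct y x

theorem signedOp_true (x y : X) : signedOp true x y = Shelf.act y x := rfl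

theorem signedOp_false (x y : X) : signedOp false x y = Rack.invAct y x := rfl

theorem signedOp_self (b : Bool) (x : X) : signedOp b x x = x := by
  cases b
  · exact Quandle.fix_inv
  · exact Quandle.fix

theorem signedOp_not_signedOp (b : Bool) (x y : X) : signedOp (!b) (signedOp b x y) y = x := by
  cases b
  · exact Rack.act_invAct_eq y x
  · exact Rack.invAct_act_eq y x

theorem signedOp_signedOp_not (b : Bool) (x y : X) : signedOp b (signedOp (!b) x y) y = x := by
  simpa using signedOp_not_signedOp (!b) x y

theorem signedOp_eq_iff {b : Bool} {x y z : X} : signedOp b x y = z ↔ signedOp (!b) z y = x := by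
  constructor
  · rintro rfl; exact signedOp_not_signedOp b x y
  · rintro rfl; exact signedOp_signedOp_not b z y

theorem signedOp_left_injective {b : Bool} {x x' y : X} (h : signedOp b x y = signedOp b x' y) :
    x = x' := by
  rw [← signedOp_not_signedOp b x y, h, signedOp_not_signedOp]

theorem signedOp_true_distrib (b : Bool) (x y z : X) :
    signedOp true (signedOp b x y) z = signedOp b (signedOp true x z) (signedOp true y z) := by
  cases b
  · rw [eq_comm, signedOp_eq_iff]
    simp only [Bool.not_false, signedOp_true, signedOp_false]
    rw [← Shelf.self_distrib, Rack.act_invAct_eq]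
  · exact Shelf.self_distrib

/-- Each translation by `z`, forward or backward, is an automorphism of the quandle, so it preserves
both the operation and its inverse. -/
theorem signedOp_distrib (a b : Bool) (x y z : X) :
    signedOp a (signedOp b x y) z = signedOp b (signedOp a x z) (signedOp a y z) := by
  cases a
  · rw [signedOp_eq_iff, Bool.not_false, signedOp_true_distrib]
    have h := fun w : X => signedOp_signedOp_not true w z
    simp only [Bool.not_true] at h
    rw [h, h]
  · exact signedOp_true_distrib b x y z

theorem ShelfHom.map_signedOp (f : ShelfHom X X) (b : Bool) (x y : X) :
    f (signedOp b x y) = signedOp b (f x) (f y) := by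
  cases b
  · rw [eq_comm, signedOp_eq_iff]
    simp only [Bool.not_false, signedOp_true, signedOp_false]
    rw [← ShelfHom.map_act, Rack.act_invAct_eq]
  · exact f.map_act

end SignedOperation

namespace LinkDiagram

/-! ### Elementary geometry of diagrams -/

section Geometry

variable {D : LinkDiagram}

@[simp] theorem next_prev (v : D.V) : D.next (D.prev v) = v := D.next.apply_symm_apply v

@[simp] theorem prev_next (v : D.V) : D.prev (D.next v) = v := D.next.symm_apply_apply v

theorem next_ne (v : D.V) : D.next v ≠ v := fun h => D.pos_next_ne v (congrArg D.pos h)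

/-- A polygon with two edges would run twice along the same open segment, against `edges_disjoint`.
-/
theorem next_next_ne (v : D.V) : D.next (D.next v) ≠ v := by
  intro h
  have h1 := D.edges_disjoint v (D.next v) (next_ne v).symm
  rw [h, openSegment_symm ℝ (D.pos (D.next v))] at h1
  exact Set.disjoint_left.1 h1 (D.mid_mem_openSegment v) (D.mid_mem_openSegment v)

theorem IsCrossing.not_over {o u w : D.V} (h : D.IsCrossing o u) : ¬ D.IsCrossing u w :=
  fun h' => (D.over_iff o u h.1 h.2.1).1 h.2.2 h'.2.2

theorem IsCrossing.not_under {o u w : D.V} (h : D.IsCrossing o u) : ¬ D.IsCrossing w o :=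
  fun h' => h'.not_over h

theorem IsCrossing.under_unique {o u u' : D.V} (h : D.IsCrossing o u) (h' : D.IsCrossing o u') :
    u = u' := by
  rcases D.no_triple_point u o u' h.2.1.symm h'.2.1 with e | e | e
  · exact absurd e.symm h.1
  · exact absurd e h'.1
  · exact e

theorem IsCrossing.over_unique {o o' u : D.V} (h : D.IsCrossing o u) (h' : D.IsCrossing o' u) :
    o = o' := by
  rcases D.no_triple_point o u o' h.2.1 h'.2.1.symm with e | e | e
  · exact absurd e h.1
  · exact absurd e.symm h'.1
  · exact e

theorem IsCrossing.ne_next {o u : D.V} (h : D.IsCrossing o u) : u ≠ D.next o := by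
  rintro rfl
  exact D.pos_next_ne o h.2.1.symm

theorem IsCrossing.next_ne {o u : D.V} (h : D.IsCrossing o u) : D.next u ≠ o := by
  rintro rfl
  exact D.pos_next_ne u h.2.1

theorem IsMark.not_isCrossing_left {v u : D.V} (h : D.IsMark v) : ¬ D.IsCrossing v u :=
  fun h' => h u h'.1 h'.2.1

theorem IsMark.not_isCrossing_right {v o : D.V} (h : D.IsMark v) : ¬ D.IsCrossing o v :=
  fun h' => h o h'.1.symm h'.2.1.symm

theorem isCrossing_iff_exists_sign {o u : D.V} :
    D.IsCrossing o u ↔ ∃ b, D.IsSignedCrossing o u b := by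
  classical
  constructor
  · intro h
    exact ⟨decide (D.IsPositive o u), h, by simp⟩
  · rintro ⟨b, h, -⟩
    exact h

theorem IsSignedCrossing.sign_unique {o u : D.V} {b b' : Bool} (h : D.IsSignedCrossing o u b)
    (h' : D.IsSignedCrossing o u b') : b = b' := by
  have := h.2.symm.trans h'.2
  cases b <;> cases b' <;> simp_all

end Geometry

/-! ### Shadow colorings as functions on edges and regions -/

section EdgeColorings

variable {X : Type*} [Quandle X]

/-- Arc colorings, as functions on the edges. -/
structure IsArcColoring (D : LinkDiagram) (c : D.V → X) : Prop where
  eq_of_not_under : ∀ v, (¬ ∃ o, D.IsCrossing o v) → c (D.prev v) = c v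
  crossing : ∀ o u b, D.IsSignedCrossing o u b → signedOp b (c (D.prev u)) (c o) = c u

/-- The coloring condition for the regions, when the colors of the edges are given. -/
def IsRegionColoring (D : LinkDiagram) (c : D.V → X) (R : D.Region → X) : Prop :=
  ∀ v s, signedOp s (R (D.side v (!s))) (c v) = R (D.side v s)

/-- The rules for crossing an edge in the two directions are inverse to each other, so one direction
per edge is enough, and it may be chosen edge by edge. -/
theorem isRegionColoring_of_side {D : LinkDiagram} {c : D.V → X} {R : D.Region → X}
    (s : D.V → Bool)
    (h : ∀ v, signedOp (s v) (R (D.side v (!s v))) (c v) = R (D.side v (s v))) :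
    D.IsRegionColoring c R := by
  intro v t
  rcases Bool.eq_or_eq_not t (s v) with rfl | rfl
  · exact h v
  · rw [← signedOp_eq_iff, Bool.not_not]
    exact h v

/-- Shadow colorings with outer color `a`, as functions on the edges and on the regions. -/
structure IsShadowColoring (D : LinkDiagram) (a : X) (c : D.V → X) (R : D.Region → X) :
    Prop where
  arc : D.IsArcColoring c
  region : D.IsRegionColoring c R
  outer : R D.outer = a

/-- Endomorphisms act on arc colorings but not on shadow colorings with outer color `a`, because
they need not fix `a`. -/
theorem IsArcColoring.comp {D : LinkDiagram} {c : D.V → X} (h : D.IsArcColoring c)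
    (f : ShelfHom X X) : D.IsArcColoring (fun v => f (c v)) where
  eq_of_not_under v hv := congrArg f (h.eq_of_not_under v hv)
  crossing o u b hb := by
    rw [← f.map_signedOp, h.crossing o u b hb]

/-- The under-edge on the right of the over-strand at a crossing with under-vertex `u` and
sign `b`. -/
def rightEdge (D : LinkDiagram) (u : D.V) (b : Bool) : D.V := if b then D.prev u else u

/-- The crossings with their signs. -/
def signedCrossings (D : LinkDiagram) : Set (D.V × D.V × Bool) :=
  {x | D.IsSignedCrossing x.1 x.2.1 x.2.2}

/-- The contribution of a crossing to the weight. -/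
noncomputable def localWeight {X A : Type*} [AddCommGroup A] (D : LinkDiagram) (θ : X → X → X → A)
    (c : D.V → X) (R : D.Region → X) (x : D.V × D.V × Bool) : A :=
  (if x.2.2 then (1 : ℤ) else -1) •
    θ (R (D.side (D.rightEdge x.2.1 x.2.2) false)) (c (D.rightEdge x.2.1 x.2.2)) (c x.1)

theorem isShadowColoring_of_coloring {D : LinkDiagram} {a : X} (C : ShadowColoring D X a) :
    D.IsShadowColoring a (fun v => C.onArc (D.arc v)) C.onRegion where
  arc :=
    { eq_of_not_under := fun v hv => congrArg C.onArc
        (Quot.sound ⟨(next_prev v).symm, hv⟩)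
      crossing := by
        intro o u b h
        have h1 := C.crossing_rule ⟨(o, u), h.1⟩
        have h2 := h.2
        cases b
        · simp only [Crossing.rightUnder, Crossing.leftUnder, Crossing.overArc, h2,
            Bool.false_eq_true, if_false] at h1
          rw [signedOp_eq_iff]
          exact h1
        · simp only [Crossing.rightUnder, Crossing.leftUnder, Crossing.overArc, h2,
            if_true] at h1
          exact h1 }
  region := isRegionColoring_of_side (fun _ => true) fun v => C.region_rule v
  outer := C.outer_color

/-- Shadow colorings are the same as pairs of functions on the edges and on the regions. -/
def shadowColoringEquiv (D : LinkDiagram) (a : X) :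
    ShadowColoring D X a ≃
      {p : (D.V → X) × (D.Region → X) // D.IsShadowColoring a p.1 p.2} where
  toFun C := ⟨(fun v => C.onArc (D.arc v), C.onRegion), isShadowColoring_of_coloring C⟩
  invFun p :=
    { onArc := Quot.lift p.1.1 (by
        rintro v w ⟨rfl, h⟩
        rw [← p.2.arc.eq_of_not_under _ h, prev_next])
      onRegion := p.1.2
      crossing_rule := by
        rintro ⟨⟨o, u⟩, h⟩
        by_cases hp : D.IsPositive o u
        · have := p.2.arc.crossing o u true ⟨h, by simpa using hp⟩
          simpa only [Crossing.rightUnder, Crossing.leftUnder, Crossing.overArc, hp, if_true]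
            using! this
        · have := p.2.arc.crossing o u false ⟨h, by simpa using hp⟩
          rw [signedOp_eq_iff] at this
          simpa only [Crossing.rightUnder, Crossing.leftUnder, Crossing.overArc, hp, if_false]
            using! this
      region_rule := fun v => p.2.region v true
      outer_color := p.2.outer }
  left_inv C := by
    ext x
    · induction x using Quot.ind
      rfl
    · rfl
  right_inv p := rfl

/-- A crossing determines its sign, so crossings and signed triples correspond bijectively. In this
form the crossings of two diagrams can be compared as sets, by images and insertions. -/
theorem weight_eq_finsum {D : LinkDiagram} {A : Type*} [AddCommGroup A] {a : X}
    (θ : X → X → X → A) (C : ShadowColoring D X a) :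
    C.weight θ = ∑ᶠ x ∈ D.signedCrossings,
      D.localWeight θ (fun v => C.onArc (D.arc v)) C.onRegion x := by
  classical
  rw [ShadowColoring.weight, ← finsum_eq_sum_of_fintype, ← finsum_mem_univ]
  refine finsum_mem_eq_of_bijOn
    (fun χ : D.Crossing => (χ.1.1, χ.1.2, decide (D.IsPositive χ.1.1 χ.1.2))) ⟨?_, ?_, ?_⟩ ?_
  · rintro ⟨⟨o, u⟩, h⟩ -
    exact ⟨h, by simp⟩
  · rintro ⟨⟨o, u⟩, h⟩ - ⟨⟨o', u'⟩, h'⟩ - e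
    simp only [Prod.mk.injEq] at e
    exact Subtype.ext (Prod.ext e.1 e.2.1)
  · rintro ⟨o, u, b⟩ h
    refine ⟨⟨(o, u), h.1⟩, trivial, ?_⟩
    have h2 : D.IsPositive o u ↔ b = true := h.2
    simp [h2]
  · rintro ⟨⟨o, u⟩, h⟩ -
    by_cases hp : D.IsPositive o u <;>
      simp [localWeight, rightEdge, Crossing.sign, Crossing.rightUnder, Crossing.overArc, hp]

end EdgeColorings

/-! ### Comparison of the colorings of two diagrams -/

/-- A bijection of the shadow colorings of two diagrams that is compatible with endomorphisms of
the quandle and preserves the weights. -/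
def ShadowEquivalent {X A : Type*} [Quandle X] [AddCommGroup A] (a : X) (θ : X → X → X → A)
    (D D' : LinkDiagram) : Prop :=
  ∃ e : ShadowColoring D X a ≃ ShadowColoring D' X a,
    (∀ v, v.weight θ = (e v).weight θ) ∧
    ∀ (f : ShelfHom X X) v w, (∀ α, w.onArc α = f.toFun (v.onArc α)) ↔
      ∀ α, (e w).onArc α = f.toFun ((e v).onArc α)

section Comparison

variable {X A : Type*} [Quandle X] [AddCommGroup A] {a : X} {θ : X → X → X → A}
  {D D' : LinkDiagram}

theorem ShadowEquivalent.refl (D : LinkDiagram) : ShadowEquivalent a θ D D :=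
  ⟨Equiv.refl _, fun _ => rfl, fun _ _ _ => Iff.rfl⟩

theorem ShadowEquivalent.symm (h : ShadowEquivalent a θ D D') : ShadowEquivalent a θ D' D := by
  obtain ⟨e, h1, h2⟩ := h
  refine ⟨e.symm, fun v => ?_, fun f v w => ?_⟩
  · rw [h1, e.apply_symm_apply]
  · rw [h2, e.apply_symm_apply, e.apply_symm_apply]

theorem ShadowEquivalent.trans {D'' : LinkDiagram} (h : ShadowEquivalent a θ D D')
    (h' : ShadowEquivalent a θ D' D'') : ShadowEquivalent a θ D D'' := by
  obtain ⟨e, h1, h2⟩ := h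
  obtain ⟨e', h1', h2'⟩ := h'
  exact ⟨e.trans e', fun v => (h1 v).trans (h1' _), fun f v w => (h2 f v w).trans (h2' f _ _)⟩

theorem ShadowEquivalent.nonempty_weightedQuiverIso (h : ShadowEquivalent a θ D D')
    (S : Set (ShelfHom X X)) :
    Nonempty (WeightedQuiverIso
      (ShadowQuiver.rho θ : ShadowQuiver D S a → A)
      (ShadowQuiver.rho θ : ShadowQuiver D' S a → A)) := by
  obtain ⟨e, h1, h2⟩ := h
  exact ⟨{ onVertex := e
           onEdge := fun v w => Equiv.subtypeEquivRight fun f => and_congr_right fun _ => h2 f v w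
           weight_eq := h1 }⟩

/-- Relations between the edge colorings and between the region colorings of two diagrams that
determine the colorings of one diagram from those of the other one give a bijection of the shadow
colorings. -/
theorem ShadowEquivalent.of_relations (P : (D.V → X) → (D'.V → X) → Prop)
    (Q : (D.Region → X) → (D'.Region → X) → Prop)
    (exists_right : ∀ c R, D.IsShadowColoring a c R →
      ∃ c' R', D'.IsShadowColoring a c' R' ∧ P c c' ∧ Q R R')
    (exists_left : ∀ c' R', D'.IsShadowColoring a c' R' →
      ∃ c R, D.IsShadowColoring a c R ∧ P c c' ∧ Q R R')
    (comp : ∀ (f : ShelfHom X X) c c', P c c' → P (fun v => f (c v)) (fun v => f (c' v)))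
    (arc_right : ∀ c c₁ c₂, D'.IsArcColoring c₁ → D'.IsArcColoring c₂ → P c c₁ → P c c₂ →
      c₁ = c₂)
    (arc_left : ∀ c' c₁ c₂, D.IsArcColoring c₁ → D.IsArcColoring c₂ → P c₁ c' → P c₂ c' →
      c₁ = c₂)
    (region_right : ∀ c' R R₁ R₂, D'.IsRegionColoring c' R₁ → D'.IsRegionColoring c' R₂ →
      Q R R₁ → Q R R₂ → R₁ = R₂)
    (region_left : ∀ c R' R₁ R₂, D.IsRegionColoring c R₁ → D.IsRegionColoring c R₂ →
      Q R₁ R' → Q R₂ R' → R₁ = R₂)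
    (weight : ∀ c R c' R', D.IsShadowColoring a c R → D'.IsShadowColoring a c' R' →
      P c c' → Q R R' → ∑ᶠ x ∈ D.signedCrossings, D.localWeight θ c R x =
        ∑ᶠ x ∈ D'.signedCrossings, D'.localWeight θ c' R' x) :
    ShadowEquivalent a θ D D' := by
  -- Needed by `choose!`, which gives values also to pairs that are not colorings.
  have : Nonempty X := ⟨a⟩
  choose! F G hFG hP hQ using exists_right
  choose! F' G' hFG' hP' hQ' using exists_left
  let e₀ : {p : (D.V → X) × (D.Region → X) // D.IsShadowColoring a p.1 p.2} ≃
      {p : (D'.V → X) × (D'.Region → X) // D'.IsShadowColoring a p.1 p.2} :=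
    { toFun := fun p => ⟨(F p.1.1 p.1.2, G p.1.1 p.1.2), hFG _ _ p.2⟩
      invFun := fun p => ⟨(F' p.1.1 p.1.2, G' p.1.1 p.1.2), hFG' _ _ p.2⟩
      left_inv := by
        rintro ⟨⟨c, R⟩, h⟩
        have h1 := hFG _ _ h
        have h2 := hFG' _ _ h1
        have hc : F' (F c R) (G c R) = c :=
          arc_left _ _ _ h2.arc h.arc (hP' _ _ h1) (hP _ _ h)
        -- Region colorings are unique only over one fixed arc coloring, so the equality of the arc
        -- colorings is substituted first.
        have h3 : D.IsRegionColoring c (G' (F c R) (G c R)) := by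
          have := h2.region
          dsimp only at this
          rwa [hc] at this
        have hR : G' (F c R) (G c R) = R :=
          region_left c _ _ _ h3 h.region (hQ' _ _ h1) (hQ _ _ h)
        exact Subtype.ext (Prod.ext hc hR)
      right_inv := by
        rintro ⟨⟨c, R⟩, h⟩
        have h1 := hFG' _ _ h
        have h2 := hFG _ _ h1
        have hc : F (F' c R) (G' c R) = c :=
          arc_right _ _ _ h2.arc h.arc (hP _ _ h1) (hP' _ _ h)
        have h3 : D'.IsRegionColoring c (G (F' c R) (G' c R)) := by
          have := h2.region
          dsimp only at this
          rwa [hc] at this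
        have hR : G (F' c R) (G' c R) = R :=
          region_right c _ _ _ h3 h.region (hQ _ _ h1) (hQ' _ _ h)
        exact Subtype.ext (Prod.ext hc hR) }
  let e := (D.shadowColoringEquiv a).trans (e₀.trans (D'.shadowColoringEquiv a).symm)
  have he : ∀ v : ShadowColoring D X a,
      (fun x => (e v).onArc (D'.arc x)) = F (fun x => v.onArc (D.arc x)) v.onRegion :=
    fun v => rfl
  have he' : ∀ v : ShadowColoring D X a,
      (e v).onRegion = G (fun x => v.onArc (D.arc x)) v.onRegion := fun v => rfl
  refine ⟨e, fun v => ?_, fun f v w => ?_⟩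
  · have hv := isShadowColoring_of_coloring v
    rw [weight_eq_finsum, weight_eq_finsum, he, he']
    exact weight _ _ _ _ hv (hFG _ _ hv) (hP _ _ hv) (hQ _ _ hv)
  · have hv := isShadowColoring_of_coloring v
    have hw := isShadowColoring_of_coloring w
    -- Both `e w` and `f ∘ e v` are arc colorings related to the same coloring of `D`, although `f ∘
    -- e v` need not extend to a shadow coloring with outer color `a`.
    have key : ((fun x => w.onArc (D.arc x)) = fun x => f (v.onArc (D.arc x))) ↔
        (fun x => (e w).onArc (D'.arc x)) = fun x => f ((e v).onArc (D'.arc x)) := by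
      have pv := comp f _ _ (hP _ _ hv)
      have pw := hP _ _ hw
      rw [← he] at pv pw
      have hev := (isShadowColoring_of_coloring (e v)).arc.comp f
      have hew := (isShadowColoring_of_coloring (e w)).arc
      constructor
      · intro h
        rw [h] at pw
        exact arc_right _ _ _ hew hev pw pv
      · intro h
        rw [h] at pw
        exact arc_left _ _ _ hw.arc (hv.arc.comp f) pw pv
    constructor
    · intro h α
      induction α using Quot.ind
      exact congrFun (key.1 (funext fun x => h _)) _
    · intro h α
      induction α using Quot.ind
      exact congrFun (key.2 (funext fun x => h _)) _

end Comparison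

/-! ### Transport of the weight contributions along maps of vertices. -/

section LocalWeight

variable {X A : Type*} [AddCommGroup A] {θ : X → X → X → A}
  {D D' : LinkDiagram} {c : D.V → X} {R : D.Region → X} {c' : D'.V → X} {R' : D'.Region → X}

theorem localWeight_eq {o u : D.V} {o' u' : D'.V} {b : Bool} (ho : c' o' = c o)
    (hu : c' u' = c u) (hp : c' (D'.prev u') = c (D.prev u))
    (hRu : R' (D'.side u' false) = R (D.side u false))
    (hRp : R' (D'.side (D'.prev u') false) = R (D.side (D.prev u) false)) :
    D'.localWeight θ c' R' (o', u', b) = D.localWeight θ c R (o, u, b) := by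
  cases b <;> simp [localWeight, rightEdge, *]

/-- The map of triples (over-vertex, under-vertex, sign) induced by a map of the vertices. -/
def mapCrossing (φ : D.V → D'.V) (x : D.V × D.V × Bool) : D'.V × D'.V × Bool :=
  (φ x.1, φ x.2.1, x.2.2)

theorem mapCrossing_injective {φ : D.V → D'.V} (hφ : Function.Injective φ) :
    Function.Injective (mapCrossing φ) := by
  rintro ⟨o, u, b⟩ ⟨o', u', b'⟩ h
  simp only [mapCrossing, Prod.mk.injEq] at h
  rw [hφ h.1, hφ h.2.1, h.2.2]

theorem finsum_localWeight_image {φ : D.V → D'.V} (hφ : Function.Injective φ)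
    {S : Set (D.V × D.V × Bool)}
    (h : ∀ o u b, (o, u, b) ∈ S → D'.localWeight θ c' R' (φ o, φ u, b) =
      D.localWeight θ c R (o, u, b)) :
    ∑ᶠ x ∈ mapCrossing φ '' S, D'.localWeight θ c' R' x = ∑ᶠ x ∈ S, D.localWeight θ c R x := by
  rw [finsum_mem_image (mapCrossing_injective hφ).injOn]
  exact finsum_mem_congr rfl fun x hx => h _ _ _ hx

theorem map_prev {φ : D.V → D'.V} (h : ∀ v, φ (D.next v) = D'.next (φ v)) (v : D.V) :
    D'.prev (φ v) = φ (D.prev v) := by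
  conv_lhs => rw [← next_prev v, h, prev_next]

end LocalWeight

/-! ### Planar isotopy. -/

section Isotopy

variable {X A : Type*} [Quandle X] [AddCommGroup A] {a : X} {θ : X → X → X → A}
  {D D' : LinkDiagram}

theorem PlanarIsotopic.shadowEquivalent (h : PlanarIsotopic D D') :
    ShadowEquivalent a θ D D' := by
  obtain ⟨φ, ψ, hnext, hcr, hside, houter⟩ := h
  have hprev := map_prev hnext
  have hunder : ∀ v, (∃ o, D'.IsCrossing o (φ v)) ↔ ∃ o, D.IsCrossing o v := by
    intro v
    simp only [isCrossing_iff_exists_sign, φ.exists_congr_left, ← hcr, Equiv.apply_symm_apply]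
  have key : ∀ (c : D'.V → X) (R : D'.Region → X),
      D'.IsShadowColoring a c R ↔ D.IsShadowColoring a (c ∘ φ) (R ∘ ψ) := by
    intro c R
    constructor
    · intro h
      refine ⟨⟨fun v hv => ?_, fun o u b hb => ?_⟩, fun v s => ?_, ?_⟩
      · have := h.arc.eq_of_not_under (φ v) (by rwa [hunder])
        rwa [hprev] at this
      · have := h.arc.crossing _ _ _ ((hcr _ _ _).2 hb)
        rwa [hprev] at this
      · simpa only [hside, Function.comp_apply] using h.region (φ v) s
      · simpa [houter] using h.outer
    · intro h
      refine ⟨⟨fun v hv => ?_, fun o u b hb => ?_⟩, fun v s => ?_, ?_⟩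
      · obtain ⟨v, rfl⟩ := φ.surjective v
        rw [hprev]
        exact h.arc.eq_of_not_under v (by rwa [← hunder])
      · obtain ⟨o, rfl⟩ := φ.surjective o
        obtain ⟨u, rfl⟩ := φ.surjective u
        rw [hprev]
        exact h.arc.crossing _ _ _ ((hcr _ _ _).1 hb)
      · obtain ⟨v, rfl⟩ := φ.surjective v
        rw [hside, hside]
        exact h.region v s
      · rw [← houter]
        exact h.outer
  refine .of_relations (fun c c' => ∀ v, c' (φ v) = c v) (fun R R' => ∀ r, R' (ψ r) = R r)
    (fun c R h => ⟨c ∘ φ.symm, R ∘ ψ.symm, ?_, by simp, by simp⟩)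
    (fun c' R' h => ⟨c' ∘ φ, R' ∘ ψ, (key c' R').1 h, fun _ => rfl, fun _ => rfl⟩)
    (fun f c c' h v => congrArg f (h v))
    (fun c c₁ c₂ _ _ h₁ h₂ => ?_)
    (fun c c₁ c₂ _ _ h₁ h₂ => funext fun v => by rw [← h₁, ← h₂])
    (fun _ R R₁ R₂ _ _ h₁ h₂ => ?_)
    (fun _ c c₁ c₂ _ _ h₁ h₂ => funext fun v => by rw [← h₁, ← h₂]) ?_
  · rw [key]
    simpa [Function.comp_assoc] using h
  · funext v
    obtain ⟨v, rfl⟩ := φ.surjective v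
    rw [h₁, h₂]
  · funext v
    obtain ⟨v, rfl⟩ := ψ.surjective v
    rw [h₁, h₂]
  · intro c R c' R' _ _ hP hQ
    have : D'.signedCrossings = mapCrossing φ '' D.signedCrossings := by
      ext ⟨o, u, b⟩
      obtain ⟨o, rfl⟩ := φ.surjective o
      obtain ⟨u, rfl⟩ := φ.surjective u
      rw [show (φ o, φ u, b) = mapCrossing φ (o, u, b) from rfl,
        (mapCrossing_injective φ.injective).mem_set_image]
      exact hcr o u b
    rw [this, finsum_localWeight_image φ.injective]
    rintro o u b -
    exact localWeight_eq (hP o) (hP u) (by rw [hprev, hP]) (by rw [hside, hQ])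
      (by rw [hprev, hside, hQ])

end Isotopy

/-! ### Subdivision of an edge. -/

section Subdivision

variable {X A : Type*} [Quandle X] [AddCommGroup A] {a : X} {θ : X → X → X → A}
  {D D' : LinkDiagram}

/-- The new vertex is not a crossing point, so the two halves of the subdivided edge have the same
color and the same adjacent regions, and nothing depends on which half is meant. -/
theorem Subdivision.shadowEquivalent (h : Subdivision D D') : ShadowEquivalent a θ D D' := by
  obtain ⟨ι, m, e, ψ, hι, hm, hnexte, hnextm, hnext, hmark, hcr, hside, hsidem, houter⟩ := h
  have hmne : ∀ v, ι v ≠ m := fun v => (hm _).2 ⟨v, rfl⟩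
  have hcases : ∀ v', v' = m ∨ ∃ v, ι v = v' := by
    intro v'
    by_cases h : v' = m
    · exact .inl h
    · exact .inr ((hm v').1 h)
  have hprevm : D'.prev m = ι e := by rw [← hnexte, prev_next]
  -- Only at the end of `e` does `ι` fail to respect predecessors; there `m` takes the place of `ι
  -- e`.
  have hprev : ∀ v, D'.prev (ι v) = m ∧ D.prev v = e ∨ D'.prev (ι v) = ι (D.prev v) := by
    intro v
    by_cases h : D.prev v = e
    · left
      refine ⟨?_, h⟩
      rw [← next_prev v, h, ← hnextm, prev_next]
    · right
      conv_lhs => rw [← next_prev v, ← hnext _ h, prev_next]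
  have hover : ∀ o' v, D'.IsCrossing o' (ι v) → ∃ o, ι o = o' ∧ D.IsCrossing o v := by
    intro o' v h
    rcases hcases o' with rfl | ⟨o, rfl⟩
    · exact absurd h hmark.not_isCrossing_left
    · refine ⟨o, rfl, ?_⟩
      rw [isCrossing_iff_exists_sign] at h ⊢
      simpa only [hcr] using h
  have hunder : ∀ v, (∃ o, D'.IsCrossing o (ι v)) ↔ ∃ o, D.IsCrossing o v := by
    intro v
    constructor
    · rintro ⟨o', h⟩
      obtain ⟨o, -, h⟩ := hover o' v h
      exact ⟨o, h⟩
    · rintro ⟨o, h⟩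
      refine ⟨ι o, ?_⟩
      rw [isCrossing_iff_exists_sign] at h ⊢
      simpa only [hcr] using h
  have hcm : ∀ c : D'.V → X, D'.IsArcColoring c → c m = c (ι e) := by
    intro c hc
    rw [← hprevm, hc.eq_of_not_under]
    rintro ⟨o, ho⟩
    exact hmark.not_isCrossing_right ho
  have hsc : ∀ o' u' b, D'.IsSignedCrossing o' u' b →
      ∃ o u, ι o = o' ∧ ι u = u' ∧ D.IsSignedCrossing o u b := by
    intro o' u' b h
    rcases hcases u' with rfl | ⟨u, rfl⟩
    · exact absurd h.1 hmark.not_isCrossing_right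
    · obtain ⟨o, rfl, -⟩ := hover _ _ h.1
      exact ⟨o, u, rfl, rfl, (hcr o u b).1 h⟩
  have key : ∀ (c : D'.V → X) (R : D'.Region → X), c m = c (ι e) →
      (D'.IsShadowColoring a c R ↔ D.IsShadowColoring a (c ∘ ι) (R ∘ ψ)) := by
    intro c R hc
    have hcp : ∀ v, c (D'.prev (ι v)) = c (ι (D.prev v)) := by
      intro v
      rcases hprev v with ⟨h, h'⟩ | h
      · rw [h, h', hc]
      · rw [h]
    constructor
    · intro h
      refine ⟨⟨fun v hv => ?_, fun o u b hb => ?_⟩, fun v s => ?_, ?_⟩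
      · have := h.arc.eq_of_not_under (ι v) (by rwa [hunder])
        rwa [hcp] at this
      · have := h.arc.crossing _ _ _ ((hcr _ _ _).2 hb)
        rwa [hcp] at this
      · simpa only [hside, Function.comp_apply] using h.region (ι v) s
      · simpa [houter] using h.outer
    · intro h
      refine ⟨⟨fun v hv => ?_, fun o u b hb => ?_⟩, fun v s => ?_, ?_⟩
      · rcases hcases v with rfl | ⟨v, rfl⟩
        · rw [hprevm, hc]
        · rw [hcp]
          exact h.arc.eq_of_not_under v (by rwa [← hunder])
      · obtain ⟨o, u, rfl, rfl, hb'⟩ := hsc _ _ _ hb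
        rw [hcp]
        exact h.arc.crossing _ _ _ hb'
      · rcases hcases v with rfl | ⟨v, rfl⟩
        · rw [hsidem, hsidem, hc]
          exact h.region e s
        · rw [hside, hside]
          exact h.region v s
      · rw [← houter]
        exact h.outer
  refine .of_relations (fun c c' => ∀ v, c' (ι v) = c v) (fun R R' => ∀ r, R' (ψ r) = R r)
    (fun c R h => ?_)
    (fun c' R' h => ⟨c' ∘ ι, R' ∘ ψ, (key c' R' (hcm c' h.arc)).1 h, fun _ => rfl,
      fun _ => rfl⟩)
    (fun f c c' h v => congrArg f (h v))
    (fun c c₁ c₂ hc₁ hc₂ h₁ h₂ => ?_)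
    (fun c c₁ c₂ _ _ h₁ h₂ => funext fun v => by rw [← h₁, ← h₂])
    (fun _ R R₁ R₂ _ _ h₁ h₂ => ?_)
    (fun _ c c₁ c₂ _ _ h₁ h₂ => funext fun v => by rw [← h₁, ← h₂]) ?_
  · classical
    have hc : ∀ v, (Function.extend ι c fun _ => c e) (ι v) = c v := fun v => hι.extend_apply ..
    refine ⟨Function.extend ι c fun _ => c e, R ∘ ψ.symm, ?_, hc, by simp⟩
    rw [key]
    · have : (Function.extend ι c fun _ => c e) ∘ ι = c := funext hc
      simpa [Function.comp_assoc, this] using h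
    · rw [hc]
      exact Function.extend_apply' _ _ _ fun ⟨v, hv⟩ => hmne v hv
  · funext v
    rcases hcases v with rfl | ⟨v, rfl⟩
    · rw [hcm _ hc₁, hcm _ hc₂, h₁, h₂]
    · rw [h₁, h₂]
  · funext v
    obtain ⟨v, rfl⟩ := ψ.surjective v
    rw [h₁, h₂]
  · intro c R c' R' _ h' hP hQ
    have : D'.signedCrossings = mapCrossing ι '' D.signedCrossings := by
      ext ⟨o, u, b⟩
      constructor
      · intro hb
        obtain ⟨o, u, rfl, rfl, hb'⟩ := hsc _ _ _ hb
        exact ⟨(o, u, b), hb', rfl⟩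
      · rintro ⟨⟨o, u, b⟩, hb, h⟩
        rw [← h]
        exact (hcr o u b).2 hb
    rw [this, finsum_localWeight_image hι]
    rintro o u b -
    refine localWeight_eq (hP o) (hP u) ?_ (by rw [hside, hQ]) ?_
    · rcases hprev u with ⟨h, h2⟩ | h
      · rw [h, h2, hcm _ h'.arc, hP]
      · rw [h, hP]
    · rcases hprev u with ⟨h, h2⟩ | h
      · rw [h, h2, hsidem, hQ]
      · rw [h, hside, hQ]

end Subdivision

/-! ### The first Reidemeister move. -/

section ReidemeisterOne

variable {X A : Type*} [Quandle X] [AddCommGroup A] {a : X} {θ : X → X → X → A}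
  {D D' : LinkDiagram}

/-- At the kink the strand passes under itself, so by idempotence its color does not change and the
arc colorings are literally the same. The color of the new region is forced by the loop around it,
and the new crossing has a degenerate weight. -/
theorem ReidemeisterOne.shadowEquivalent (hθ : IsQuandleThreeCocycle θ)
    (h : ReidemeisterOne D D') : ShadowEquivalent a θ D D' := by
  obtain ⟨φ, ψ, p₀, p₁, p₂, p₃, s, f, m, hnext, h₁, h₂, h₃, hψ, hm, houter, hm₀, hm₁, hm₂, hm₃,
    hcr, hside, ⟨P, Q, hbefore⟩, ⟨P', Q', hloop, hends⟩⟩ := h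
  have hprev := map_prev hnext
  have hprev₁ : D.prev p₁ = p₀ := by rw [h₁, prev_next]
  have hprev₂ : D.prev p₂ = p₁ := by rw [h₂, prev_next]
  have hprev₃ : D.prev p₃ = p₂ := by rw [h₃, prev_next]
  have hnew : D'.IsSignedCrossing (φ (if f then p₀ else p₃)) (φ (if f then p₃ else p₀))
      (s != f) := (hcr _ _ _).2 (.inr ⟨rfl, rfl, rfl⟩)
  have h10 : p₁ ≠ p₀ := h₁ ▸ next_ne p₀
  have h32 : p₃ ≠ p₂ := h₃ ▸ next_ne p₂
  have h20 : p₂ ≠ p₀ := h₂ ▸ h₁ ▸ next_next_ne p₀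
  have h31 : p₃ ≠ p₁ := h₃ ▸ h₂ ▸ next_next_ne p₁
  have h30 : p₃ ≠ p₀ := by
    rintro rfl
    exact hnew.1.1 (by simp)
  have hcross : ∀ o u, D'.IsCrossing (φ o) (φ u) ↔ D.IsCrossing o u ∨
      (o = (if f then p₀ else p₃) ∧ u = (if f then p₃ else p₀)) := by
    intro o u
    simp only [isCrossing_iff_exists_sign, hcr, exists_or]
    simp
  have hunder : ∀ v, (∃ o, D'.IsCrossing o (φ v)) ↔
      (∃ o, D.IsCrossing o v) ∨ v = (if f then p₃ else p₀) := by
    intro v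
    simp only [φ.surjective.exists, hcross, exists_or]
    simp
  have hchain : ∀ d : D.V → X, D.IsArcColoring d →
      d (D.prev p₀) = d p₁ ∧ d p₀ = d p₁ ∧ d p₂ = d p₁ ∧ d p₃ = d p₁ := by
    intro d hd
    have e : ∀ v, D.IsMark v → d (D.prev v) = d v := fun v hv =>
      hd.eq_of_not_under v fun ⟨o, ho⟩ => hv.not_isCrossing_right ho
    have e₀ := e _ hm₀
    have e₁ := e _ hm₁
    have e₂ := e _ hm₂
    have e₃ := e _ hm₃
    rw [hprev₁] at e₁
    rw [hprev₂] at e₂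
    rw [hprev₃] at e₃
    exact ⟨e₀.trans e₁, e₁, e₂.symm, e₃.symm.trans e₂.symm⟩
  -- If the loop begins with the over-passage, idempotence gives the outgoing color directly;
  -- otherwise it gives the incoming color, after cancelling a translation.
  have hchain' : ∀ c : D'.V → X, D'.IsArcColoring c →
      c (φ (D.prev p₀)) = c (φ p₀) ∧ c (φ p₂) = c (φ p₃) := by
    intro c hc
    have e : ∀ v, D.IsMark v → v ≠ (if f then p₃ else p₀) → c (φ (D.prev v)) = c (φ v) := by
      intro v hv hv'
      rw [← hprev]
      refine hc.eq_of_not_under _ ?_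
      rw [hunder]
      rintro (⟨o, ho⟩ | h)
      · exact hv.not_isCrossing_right ho
      · exact hv' h
    have e₁ : c (φ p₀) = c (φ p₁) := by
      have := e p₁ hm₁ (by cases f; exacts [h10, h31.symm])
      rwa [hprev₁] at this
    have e₂ : c (φ p₁) = c (φ p₂) := by
      have := e p₂ hm₂ (by cases f; exacts [h20, h32.symm])
      rwa [hprev₂] at this
    have hx := hc.crossing _ _ _ hnew
    cases f
    · have e₃ := e p₃ hm₃ (by simpa using h30)
      simp only [Bool.false_eq_true, if_false, hprev] at hx
      rw [hprev₃] at e₃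
      have e₄ : c (φ p₃) = c (φ p₀) := by rw [← e₃, ← e₂, ← e₁]
      rw [e₄] at hx
      exact ⟨signedOp_left_injective (hx.trans (signedOp_self _ _).symm), e₃⟩
    · have e₀ := e p₀ hm₀ (by simpa using h30.symm)
      simp only [if_true, hprev, hprev₃] at hx
      rw [e₁, e₂, signedOp_self] at hx
      exact ⟨e₀, hx⟩
  have harc : ∀ c : D'.V → X, D'.IsArcColoring c ↔ D.IsArcColoring (c ∘ φ) := by
    intro c
    constructor
    · intro h
      refine ⟨fun v hv => ?_, fun o u b hb => ?_⟩
      · by_cases hv₀ : v = p₀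
        · subst hv₀
          exact (hchain' c h).1
        by_cases hv₃ : v = p₃
        · subst hv₃
          rw [hprev₃]
          exact (hchain' c h).2
        have := h.eq_of_not_under (φ v) (by
          rw [hunder]
          rintro (h | h)
          · exact hv h
          · cases f <;> simp_all)
        rwa [hprev] at this
      · have := h.crossing _ _ _ ((hcr _ _ _).2 (.inl hb))
        rwa [hprev] at this
    · intro h
      obtain ⟨e, e₀, e₂, e₃⟩ := hchain _ h
      simp only [Function.comp_apply] at e e₀ e₂ e₃
      refine ⟨fun v hv => ?_, fun o u b hb => ?_⟩
      · obtain ⟨v, rfl⟩ := φ.surjective v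
        rw [hprev]
        exact h.eq_of_not_under v fun hv' => hv ((hunder v).2 (.inl hv'))
      · obtain ⟨o, rfl⟩ := φ.surjective o
        obtain ⟨u, rfl⟩ := φ.surjective u
        rw [hprev]
        rcases (hcr _ _ _).1 hb with hb | ⟨rfl, rfl, rfl⟩
        · exact h.crossing _ _ _ hb
        · cases f <;> simp [e, e₀, e₂, e₃, hprev₃, signedOp_self]
  have hside₃ : ∀ b, D'.side (φ p₃) b = ψ (D.side p₃ b) := hside p₃ h30 h31 h32
  have hb₃ := hbefore p₃ (by simp)
  -- The edge `p₃` leaves the disk: it appears in both local pictures and its sides are matched by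
  -- `ψ`.
  have hP : P' = ψ P := by rw [← hb₃.1, ← hside₃, (hends p₃ (.inr rfl)).1]
  have hregion : ∀ (c : D'.V → X) (R : D'.Region → X), D'.IsArcColoring c →
      (D'.IsRegionColoring c R ↔
        D.IsRegionColoring (c ∘ φ) (R ∘ ψ) ∧ R m = signedOp s (R (ψ P)) (c (φ p₁))) := by
    intro c R hc
    obtain ⟨-, e₀, e₂, e₃⟩ := hchain _ ((harc c).1 hc)
    simp only [Function.comp_apply] at e₀ e₂ e₃
    have hedge : ∀ v, v = p₀ ∨ v = p₁ ∨ v = p₂ → c (φ v) = c (φ p₁) := by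
      rintro v (rfl | rfl | rfl)
      exacts [e₀, rfl, e₂]
    constructor
    · intro h
      refine ⟨isRegionColoring_of_side (fun _ => s) fun v => ?_, ?_⟩
      · simp only [Function.comp_apply]
        by_cases hv : v = p₀ ∨ v = p₁ ∨ v = p₂
        · have h1 := hbefore v (.inr (hv.imp_right (.imp_right .inl)))
          rw [h1.1, h1.2, hedge v hv, ← e₃, ← hb₃.1, ← hb₃.2, ← hside₃, ← hside₃]
          exact h _ _
        · push Not at hv
          rw [← hside v hv.1 hv.2.1 hv.2.2, ← hside v hv.1 hv.2.1 hv.2.2]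
          exact h _ _
      · have := h (φ p₁) s
        rw [(hloop p₁ (by simp)).1, (hloop p₁ (by simp)).2, hP] at this
        exact this.symm
    · rintro ⟨h, h'⟩
      refine isRegionColoring_of_side (fun _ => s) fun v => ?_
      obtain ⟨v, rfl⟩ := φ.surjective v
      by_cases hv : v = p₀ ∨ v = p₁ ∨ v = p₂
      · rw [(hloop v hv).1, (hloop v hv).2, h', hedge v hv, hP]
      · push Not at hv
        rw [hside v hv.1 hv.2.1 hv.2.2, hside v hv.1 hv.2.1 hv.2.2]
        exact h _ _
  refine .of_relations (fun c c' => ∀ v, c' (φ v) = c v) (fun R R' => ∀ r, R' (ψ r) = R r)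
    (fun c R h => ?_)
    (fun c' R' h => ⟨c' ∘ φ, R' ∘ ψ,
      ⟨(harc c').1 h.arc, ((hregion c' R' h.arc).1 h.region).1, ?_⟩,
      fun _ => rfl, fun _ => rfl⟩)
    (fun f c c' h v => congrArg f (h v))
    (fun c c₁ c₂ _ _ h₁ h₂ => ?_)
    (fun c c₁ c₂ _ _ h₁ h₂ => funext fun v => by rw [← h₁, ← h₂])
    (fun c R R₁ R₂ hR₁ hR₂ h₁ h₂ => ?_)
    (fun _ c c₁ c₂ _ _ h₁ h₂ => funext fun v => by rw [← h₁, ← h₂]) ?_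
  · classical
    set R' := Function.extend ψ R fun _ => signedOp s (R P) (c p₁) with hR'
    have hR : ∀ r, R' (ψ r) = R r := fun r => hψ.extend_apply ..
    have hRm : R' m = signedOp s (R P) (c p₁) :=
      Function.extend_apply' _ _ _ fun ⟨r, hr⟩ => (hm m).2 ⟨r, hr⟩ rfl
    have hcφ : (c ∘ φ.symm) ∘ φ = c := by simp [Function.comp_assoc]
    have hc' : D'.IsArcColoring (c ∘ φ.symm) := by
      rw [harc, hcφ]
      exact h.arc
    refine ⟨c ∘ φ.symm, R', ⟨hc', ?_, ?_⟩, by simp, hR⟩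
    · rw [hregion _ _ hc', hcφ, show R' ∘ ψ = R from funext hR]
      refine ⟨h.region, ?_⟩
      simp [hR, hRm]
    · rw [← houter, hR]
      exact h.outer
  · rw [Function.comp_apply, houter]
    exact h.outer
  · funext v
    obtain ⟨v, rfl⟩ := φ.surjective v
    rw [h₁, h₂]
  · funext r
    by_cases hr : r = m
    · have e₁ := hR₁ (φ p₁) s
      have e₂ := hR₂ (φ p₁) s
      rw [(hloop p₁ (by simp)).1, (hloop p₁ (by simp)).2, hP] at e₁ e₂
      rw [hr, ← e₁, ← e₂, h₁, h₂]
    · obtain ⟨r, rfl⟩ := (hm r).1 hr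
      rw [h₁, h₂]
  · intro c R c' R' h h' hc hR
    have himage : D'.signedCrossings = insert (φ (if f then p₀ else p₃),
        φ (if f then p₃ else p₀), s != f) (mapCrossing φ '' D.signedCrossings) := by
      ext ⟨o, u, b⟩
      obtain ⟨o, rfl⟩ := φ.surjective o
      obtain ⟨u, rfl⟩ := φ.surjective u
      rw [Set.mem_insert_iff, show (φ o, φ u, b) = mapCrossing φ (o, u, b) from rfl,
        (mapCrossing_injective φ.injective).mem_set_image, or_comm]
      simp only [mapCrossing, Prod.mk.injEq, φ.injective.eq_iff]
      exact hcr o u b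
    have hnot : (φ (if f then p₀ else p₃), φ (if f then p₃ else p₀), s != f) ∉
        mapCrossing φ '' D.signedCrossings := by
      rw [show (φ (if f then p₀ else p₃), φ (if f then p₃ else p₀), s != f) =
        mapCrossing φ (if f then p₀ else p₃, if f then p₃ else p₀, s != f) from rfl,
        (mapCrossing_injective φ.injective).mem_set_image]
      rintro ⟨hx, -⟩
      cases f
      · exact hm₃.not_isCrossing_left hx
      · exact hm₀.not_isCrossing_left hx
    rw [himage, finsum_mem_insert _ hnot (Set.toFinite _),
      finsum_localWeight_image (c := c) (R := R) φ.injective]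
    · obtain ⟨e, e₀, e₂, e₃⟩ := hchain c h.arc
      have hzero : D'.localWeight θ c' R' (φ (if f then p₀ else p₃),
          φ (if f then p₃ else p₀), s != f) = 0 := by
        have hr : c' (D'.rightEdge (φ (if f then p₃ else p₀)) (s != f)) =
            c' (φ (if f then p₀ else p₃)) := by
          rw [rightEdge]
          split_ifs <;> simp [hprev, hc, hprev₃, e, e₀, e₂, e₃]
        rw [localWeight, hr, hθ.right_degenerate, smul_zero]
      rw [hzero, zero_add]
    · intro o u b hx
      -- The named vertices are marks, so neither under-edge at an old crossing is one of the three
      -- edges in the disk.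
      have hu : ∀ v, D.IsMark v → u ≠ v := by
        rintro _ hv rfl
        exact hv.not_isCrossing_right hx.1
      have hu₀ := hu _ hm₀
      have hu₁ := hu _ hm₁
      have hu₂ := hu _ hm₂
      have hp : ∀ v, u ≠ D.next v → D.prev u ≠ v := by
        rintro v hv rfl
        exact hv (next_prev u).symm
      have hsp := hside _ (hp p₀ (h₁ ▸ hu₁)) (hp p₁ (h₂ ▸ hu₂)) (hp p₂ (h₃ ▸ hu _ hm₃))
      exact localWeight_eq (hc o) (hc u) (by rw [hprev, hc])
        (by rw [hside u hu₀ hu₁ hu₂, hR]) (by rw [hprev, hsp, hR])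

end ReidemeisterOne

/-! ### The second Reidemeister move. -/

section ReidemeisterTwo

variable {X A : Type*} [Quandle X] [AddCommGroup A] {a : X} {θ : X → X → X → A}
  {D D' : LinkDiagram}

/-- Passing under the other strand twice applies a translation and its inverse, so the lower strand
leaves the disk with its old color and only `q₀`, `q₁` are recolored. The new region can be entered
through either strand; the two resulting colors agree by self-distributivity. -/
theorem ReidemeisterTwo.shadowEquivalent (h : ReidemeisterTwo D D') :
    ShadowEquivalent a θ D D' := by
  obtain ⟨φ, π, p₀, p₁, p₂, q₀, q₁, q₂, s, t, m, M₁, M₂, hnext, hp₁, hp₂, hq₁, hq₂, hπ, hπeq,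
    houterm, houter, mp₀, mp₁, mp₂, mq₀, mq₁, mq₂, hcr', hside, ⟨P, Q, M, hbp, hbq⟩,
    ⟨P', Q', hap, haq, hap₀, hap₂, haq₁, haq₂⟩⟩ := h
  have hprev := map_prev hnext
  have hprev_p₁ : D.prev p₁ = p₀ := by rw [hp₁, prev_next]
  have hprev_p₂ : D.prev p₂ = p₁ := by rw [hp₂, prev_next]
  have hprev_q₁ : D.prev q₁ = q₀ := by rw [hq₁, prev_next]
  have hprev_q₂ : D.prev q₂ = q₁ := by rw [hq₂, prev_next]
  -- Naming the new crossings by their order on the lower strand merges the parallel and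
  -- antiparallel cases: the signs are then `!s` at `q₀` and `s` at `q₂`, for every `t`.
  obtain ⟨o₀, o₂, ho, hcr⟩ : ∃ o₀ o₂, (o₀ = p₀ ∧ o₂ = p₂ ∨ o₀ = p₂ ∧ o₂ = p₀) ∧
      ∀ o u b, D'.IsSignedCrossing (φ o) (φ u) b ↔ D.IsSignedCrossing o u b ∨
        (o = o₀ ∧ u = q₀ ∧ b = !s) ∨ (o = o₂ ∧ u = q₂ ∧ b = s) := by
    rcases Bool.eq_or_eq_not t s with rfl | rfl
    · refine ⟨p₂, p₀, .inr ⟨rfl, rfl⟩, fun o u b => ?_⟩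
      rw [hcr', if_pos rfl, if_pos rfl, or_comm (a := o = p₀ ∧ _)]
    · refine ⟨p₀, p₂, .inl ⟨rfl, rfl⟩, fun o u b => ?_⟩
      rw [hcr', if_neg (by simp), if_neg (by simp), Bool.not_not]
  have hQ' : D'.side (φ (D.prev q₀)) (!t) = Q' := by
    by_cases hst : s = t
    · exact (haq₂ _ (by rw [if_pos hst])).2
    · exact (haq₁ _ (by rw [if_neg hst])).2
  have new₀ : D'.IsCrossing (φ o₀) (φ q₀) := ((hcr _ _ _).2 (.inr (.inl ⟨rfl, rfl, rfl⟩))).1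
  have new₂ : D'.IsCrossing (φ o₂) (φ q₂) := ((hcr _ _ _).2 (.inr (.inr ⟨rfl, rfl, rfl⟩))).1
  -- distinctness of the edges in the disk
  have hne : ∀ {o u}, D'.IsCrossing (φ o) (φ u) → u ≠ D.next o ∧ D.next u ≠ o := by
    intro o u h
    refine ⟨fun e => h.ne_next ?_, fun e => h.next_ne ?_⟩
    · rw [← hnext, e]
    · rw [← hnext, e]
  have p₂p₁ : p₂ ≠ p₁ := hp₂ ▸ next_ne p₁
  have p₂p₀ : p₂ ≠ p₀ := hp₂ ▸ hp₁ ▸ next_next_ne p₀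
  have q₁q₀ : q₁ ≠ q₀ := hq₁ ▸ next_ne q₀
  have q₂q₁ : q₂ ≠ q₁ := hq₂ ▸ next_ne q₁
  have q₂q₀ : q₂ ≠ q₀ := hq₂ ▸ hq₁ ▸ next_next_ne q₀
  have o₀q₂ : o₀ ≠ q₂ := by rintro rfl; exact new₀.not_under new₂
  have o₂q₀ : o₂ ≠ q₀ := by rintro rfl; exact new₂.not_under new₀
  have o₀q₀ : o₀ ≠ q₀ := by rintro rfl; exact new₀.not_under new₀
  have o₂q₂ : o₂ ≠ q₂ := by rintro rfl; exact new₂.not_under new₂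
  have p₀q₀ : p₀ ≠ q₀ := by rcases ho with ⟨rfl, rfl⟩ | ⟨rfl, rfl⟩ <;> assumption
  have p₀q₂ : p₀ ≠ q₂ := by rcases ho with ⟨rfl, rfl⟩ | ⟨rfl, rfl⟩ <;> assumption
  have p₂q₀ : p₂ ≠ q₀ := by rcases ho with ⟨rfl, rfl⟩ | ⟨rfl, rfl⟩ <;> assumption
  have p₂q₂ : p₂ ≠ q₂ := by rcases ho with ⟨rfl, rfl⟩ | ⟨rfl, rfl⟩ <;> assumption
  -- The vertex `p₁` follows one over-vertex and precedes the other, and consecutive vertices cannot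
  -- have the same position.
  have p₁q₀ : p₁ ≠ q₀ := by
    rintro h
    have := hne new₀
    rcases ho with ⟨rfl, rfl⟩ | ⟨rfl, rfl⟩
    · exact this.1 (by rw [← h, hp₁])
    · exact this.2 (by rw [← h, hp₂])
  have p₁q₂ : p₁ ≠ q₂ := by
    rintro h
    have := hne new₂
    rcases ho with ⟨rfl, rfl⟩ | ⟨rfl, rfl⟩
    · exact this.2 (by rw [← h, hp₂])
    · exact this.1 (by rw [← h, hp₁])
  have o₀q₁ : o₀ ≠ q₁ := fun h => (hne new₀).2 (by rw [h, hq₁])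
  have o₂q₁ : o₂ ≠ q₁ := fun h => (hne new₂).1 (by rw [h, hq₂])
  have p₀q₁ : p₀ ≠ q₁ := by rcases ho with ⟨rfl, rfl⟩ | ⟨rfl, rfl⟩ <;> assumption
  have p₂q₁ : p₂ ≠ q₁ := by rcases ho with ⟨rfl, rfl⟩ | ⟨rfl, rfl⟩ <;> assumption
  have hprevne : ∀ {v w}, v ≠ D.next w → D.prev v ≠ w := by
    rintro v w h rfl
    exact h (next_prev v).symm
  have prevq₀q₀ : D.prev q₀ ≠ q₀ := hprevne (hq₁ ▸ q₁q₀.symm)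
  have prevq₀q₁ : D.prev q₀ ≠ q₁ := hprevne (hq₂ ▸ q₂q₀.symm)
  have hside_p₂ := hside p₂ p₂p₀ p₂p₁ p₂q₀ p₂q₁
  have hside_prevq₀ := hside (D.prev q₀) (hprevne (hp₁ ▸ p₁q₀.symm)) (hprevne (hp₂ ▸ p₂q₀.symm))
    prevq₀q₀ prevq₀q₁
  have hside_q₂ := hside q₂ p₀q₂.symm p₁q₂.symm q₂q₀ q₂q₁
  have hQ'm : Q' ≠ m := hQ' ▸ (hside_prevq₀ (!t)).1
  have hπQ' : π Q' = Q := by rw [← hQ', (hside_prevq₀ _).2, (hbq _ (.inl rfl)).2]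
  have hP' : D'.side (φ p₂) (!s) = P' := (hap₂ _ rfl).2
  have hP'm : P' ≠ m := hP' ▸ (hside_p₂ (!s)).1
  have hπP' : π P' = P := by rw [← hP', (hside_p₂ _).2, (hbp _ (by simp)).2]
  -- crossings
  have hunder : ∀ v, (∃ o, D'.IsCrossing o (φ v)) ↔
      (∃ o, D.IsCrossing o v) ∨ v = q₀ ∨ v = q₂ := by
    intro v
    simp only [φ.surjective.exists, isCrossing_iff_exists_sign, hcr, exists_or]
    simp
  have hmark : ∀ {v}, D.IsMark v → ∀ {o u b}, D.IsSignedCrossing o u b → o ≠ v ∧ u ≠ v := by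
    intro v hv o u b h
    constructor
    · rintro rfl; exact hv.not_isCrossing_left h.1
    · rintro rfl; exact hv.not_isCrossing_right h.1
  have hnotunder : ∀ {v}, D.IsMark v → ¬ ∃ o, D.IsCrossing o v :=
    fun hv ⟨o, ho⟩ => hv.not_isCrossing_right ho
  -- arc colorings
  have hchain : ∀ d : D.V → X, D.IsArcColoring d →
      d p₁ = d p₀ ∧ d p₂ = d p₀ ∧ d (D.prev q₀) = d q₂ ∧ d q₀ = d q₂ ∧ d q₁ = d q₂ := by
    intro d hd
    have e : ∀ {v}, D.IsMark v → d (D.prev v) = d v := fun hv =>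
      hd.eq_of_not_under _ (hnotunder hv)
    have e₁ := hprev_p₁ ▸ e mp₁
    have e₂ := hprev_p₂ ▸ e mp₂
    have e₃ := e mq₀
    have e₄ := hprev_q₁ ▸ e mq₁
    have e₅ := hprev_q₂ ▸ e mq₂
    exact ⟨e₁.symm, e₂.symm.trans e₁.symm, e₃.trans (e₄.trans e₅), e₄.trans e₅, e₅⟩
  have hchain' : ∀ c : D'.V → X, D'.IsArcColoring c →
      c (φ (D.prev p₀)) = c (φ p₀) ∧ c (φ p₁) = c (φ p₀) ∧ c (φ p₂) = c (φ p₀) ∧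
      c (φ q₀) = signedOp (!s) (c (φ (D.prev q₀))) (c (φ p₀)) ∧
      c (φ q₁) = signedOp (!s) (c (φ (D.prev q₀))) (c (φ p₀)) ∧
      c (φ (D.prev q₀)) = c (φ q₂) := by
    intro c hc
    have e : ∀ {v}, D.IsMark v → v ≠ q₀ → v ≠ q₂ → c (φ (D.prev v)) = c (φ v) := by
      intro v hv hv₀ hv₂
      rw [← hprev]
      refine hc.eq_of_not_under _ ?_
      rw [hunder]
      rintro (h | h | h)
      exacts [hnotunder hv h, hv₀ h, hv₂ h]
    have e₀ := e mp₀ p₀q₀ p₀q₂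
    have e₁ := hprev_p₁ ▸ e mp₁ p₁q₀ p₁q₂
    have e₂ := hprev_p₂ ▸ e mp₂ p₂q₀ p₂q₂
    have e₃ := hprev_q₁ ▸ e mq₁ q₁q₀ q₂q₁.symm
    have x₀ := hc.crossing _ _ _ ((hcr _ _ _).2 (.inr (.inl ⟨rfl, rfl, rfl⟩)))
    have x₂ := hc.crossing _ _ _ ((hcr _ _ _).2 (.inr (.inr ⟨rfl, rfl, rfl⟩)))
    have eo : c (φ o₀) = c (φ p₀) ∧ c (φ o₂) = c (φ p₀) := by
      rcases ho with ⟨rfl, rfl⟩ | ⟨rfl, rfl⟩ <;> simp [e₁, e₂]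
    rw [hprev, eo.1] at x₀
    rw [hprev, hprev_q₂, eo.2, ← e₃, ← x₀, signedOp_signedOp_not] at x₂
    exact ⟨e₀, e₁.symm, e₂.symm.trans e₁.symm, x₀.symm, e₃.symm.trans x₀.symm, x₂⟩
  have harc : ∀ (c : D.V → X) (c' : D'.V → X), (∀ v, v ≠ q₀ → v ≠ q₁ → c' (φ v) = c v) →
      D.IsArcColoring c → c' (φ q₀) = signedOp (!s) (c q₂) (c p₀) → c' (φ q₁) = c' (φ q₀) →
      D'.IsArcColoring c' := by
    intro c c' hcc h e₀ e₁
    have hc' : ∀ v, v ≠ q₀ → v ≠ q₁ → v ≠ q₂ → c' (φ (D.prev v)) = c (D.prev v) :=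
      fun v _ h₁ h₂ => hcc _ (hprevne (hq₁ ▸ h₁)) (hprevne (hq₂ ▸ h₂))
    obtain ⟨f₁, f₂, f₃, -, -⟩ := hchain c h
    have eo : c o₀ = c p₀ ∧ c o₂ = c p₀ := by
      rcases ho with ⟨rfl, rfl⟩ | ⟨rfl, rfl⟩ <;> simp [f₂]
    refine ⟨fun v hv => ?_, fun o u b hb => ?_⟩
    · obtain ⟨v, rfl⟩ := φ.surjective v
      rw [hunder] at hv
      push Not at hv
      obtain ⟨hv, hv₀, hv₂⟩ := hv
      rw [hprev]
      by_cases hv₁ : v = q₁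
      · rw [hv₁, hprev_q₁, e₁]
      · rw [hcc v hv₀ hv₁, hc' v hv₀ hv₁ hv₂]
        exact h.eq_of_not_under v (by simpa using hv)
    · obtain ⟨o, rfl⟩ := φ.surjective o
      obtain ⟨u, rfl⟩ := φ.surjective u
      rw [hprev]
      rcases (hcr _ _ _).1 hb with hb | ⟨rfl, rfl, rfl⟩ | ⟨rfl, rfl, rfl⟩
      · have h₀ := hmark mq₀ hb
        have h₁ := hmark mq₁ hb
        have h₂ := hmark mq₂ hb
        rw [hcc o h₀.1 h₁.1, hcc u h₀.2 h₁.2, hc' u h₀.2 h₁.2 h₂.2]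
        exact h.crossing _ _ _ hb
      · rw [hcc _ prevq₀q₀ prevq₀q₁, f₃, e₀, hcc _ o₀q₀ o₀q₁, eo.1]
      · rw [hprev_q₂, e₁, e₀, hcc _ o₂q₀ o₂q₁, eo.2, signedOp_signedOp_not, hcc _ q₂q₀ q₂q₁]
  have harc' : ∀ (c : D.V → X) (c' : D'.V → X), (∀ v, v ≠ q₀ → v ≠ q₁ → c' (φ v) = c v) →
      D'.IsArcColoring c' → c q₀ = c' (φ q₂) → c q₁ = c' (φ q₂) → D.IsArcColoring c := by
    intro c c' hcc h e₀ e₁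
    have hc' : ∀ v, v ≠ q₁ → v ≠ q₂ → c' (φ (D.prev v)) = c (D.prev v) :=
      fun v h₁ h₂ => hcc _ (hprevne (hq₁ ▸ h₁)) (hprevne (hq₂ ▸ h₂))
    refine ⟨fun v hv => ?_, fun o u b hb => ?_⟩
    · by_cases hv₀ : v = q₀
      · rw [hv₀, e₀, ← hc' _ q₁q₀.symm q₂q₀.symm, (hchain' c' h).2.2.2.2.2]
      by_cases hv₁ : v = q₁
      · rw [hv₁, hprev_q₁, e₀, e₁]
      by_cases hv₂ : v = q₂
      · rw [hv₂, hprev_q₂, e₁, hcc _ q₂q₀ q₂q₁]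
      have := h.eq_of_not_under (φ v) (by
        rw [hunder]
        rintro (h | h | h)
        exacts [hv h, hv₀ h, hv₂ h])
      rwa [hprev, hc' v hv₁ hv₂, hcc v hv₀ hv₁] at this
    · have h₀ := hmark mq₀ hb
      have h₁ := hmark mq₁ hb
      have h₂ := hmark mq₂ hb
      have := h.crossing _ _ _ ((hcr _ _ _).2 (.inl hb))
      rwa [hprev, hcc o h₀.1 h₁.1, hcc u h₀.2 h₁.2, hc' u h₁.2 h₂.2] at this
  -- region colorings
  have hside_bp : ∀ v, v = p₀ ∨ v = p₁ → ∀ b, D.side v b = D.side p₂ b := by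
    intro v hv b
    have h1 := hbp v (.inr (hv.imp_right .inl))
    have h2 := hbp p₂ (by simp)
    rcases Bool.eq_or_eq_not b s with rfl | rfl
    · rw [h1.1, h2.1]
    · rw [h1.2, h2.2]
  have hside_bq : ∀ v, v = D.prev q₀ ∨ v = q₀ ∨ v = q₁ → ∀ b, D.side v b = D.side q₂ b := by
    intro v hv b
    have h1 := hbq v (hv.imp_right (.imp_right .inl))
    have h2 := hbq q₂ (by simp)
    rcases Bool.eq_or_eq_not b t with rfl | rfl
    · rw [h1.1, h2.1]
    · rw [h1.2, h2.2]
  have hregion : ∀ (c : D.V → X) (c' : D'.V → X) (R : D.Region → X) (R' : D'.Region → X),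
      (∀ v, v ≠ q₀ → v ≠ q₁ → c' (φ v) = c v) → (∀ r', r' ≠ m → R' r' = R (π r')) →
      D.IsArcColoring c → D'.IsArcColoring c' → D.IsRegionColoring c R →
      R' m = signedOp (!s) (R Q) (c p₀) → D'.IsRegionColoring c' R' := by
    classical
    intro c c' R R' hcc hRR hc hc' h hRm
    obtain ⟨-, f₁, -, f₂, f₃, f₄⟩ := hchain' c' hc'
    obtain ⟨-, -, -, g₀, -⟩ := hchain c hc
    have hc₀ := hcc p₀ p₀q₀ p₀q₁
    have x₁ := h p₀ (!s)
    have x₂ := h q₀ (!t)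
    rw [Bool.not_not, (hbp p₀ (by simp)).1, (hbp p₀ (by simp)).2] at x₁
    rw [Bool.not_not, (hbq q₀ (by simp)).1, (hbq q₀ (by simp)).2, g₀] at x₂
    -- For the edges that bound `m`, this chooses the direction into `m`.
    refine isRegionColoring_of_side
      (fun v => if v = φ p₀ ∨ v = φ p₁ then !s else !t) fun v => ?_
    obtain ⟨v, rfl⟩ := φ.surjective v
    simp only [φ.injective.eq_iff]
    by_cases hp : v = p₀ ∨ v = p₁
    · have e : c' (φ v) = c p₀ := by
        rcases hp with e | e <;> rw [e]
        exacts [hc₀, f₁.trans hc₀]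
      rw [if_pos hp, Bool.not_not, (hap v hp).1, (hap v hp).2, hRm, e, hRR _ hQ'm, hπQ']
    rw [if_neg hp]
    by_cases hq : v = q₀ ∨ v = q₁
    · have e : c' (φ v) = signedOp (!s) (c q₂) (c p₀) := by
        rw [← hcc q₂ q₂q₀ q₂q₁, ← hc₀, ← f₄]
        rcases hq with rfl | rfl
        exacts [f₂, f₃]
      -- Starting from the common region `M`, crossing `p` and then the recolored `q` gives the same
      -- color as crossing `q` and then `p`.
      rw [Bool.not_not, (haq v hq).1, (haq v hq).2, hRm, e, hRR _ hP'm, hπP', ← x₁, ← x₂,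
        ← signedOp_distrib]
    push Not at hp hq
    have hs := hside v hp.1 hp.2 hq.1 hq.2
    rw [hRR _ (hs _).1, hRR _ (hs _).1, (hs _).2, (hs _).2, hcc v hq.1 hq.2]
    exact h v _
  have hregion' : ∀ (c : D.V → X) (c' : D'.V → X) (R : D.Region → X) (R' : D'.Region → X),
      (∀ v, v ≠ q₀ → v ≠ q₁ → c' (φ v) = c v) → (∀ r', r' ≠ m → R' r' = R (π r')) →
      D.IsArcColoring c → D'.IsRegionColoring c' R' → D.IsRegionColoring c R := by
    intro c c' R R' hcc hRR hc h
    obtain ⟨f₁, f₂, -, f₃, f₄⟩ := hchain c hc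
    have key : ∀ v, v ≠ p₀ → v ≠ p₁ → v ≠ q₀ → v ≠ q₁ → ∀ b,
        signedOp b (R (D.side v (!b))) (c v) = R (D.side v b) := by
      intro v hp₀ hp₁ hq₀ hq₁ b
      have hs := hside v hp₀ hp₁ hq₀ hq₁
      rw [← (hs _).2, ← (hs _).2, ← hRR _ (hs _).1, ← hRR _ (hs _).1, ← hcc v hq₀ hq₁]
      exact h (φ v) b
    intro v b
    by_cases hp : v = p₀ ∨ v = p₁
    · have e : c v = c p₂ := by
        rcases hp with e | e <;> rw [e]
        exacts [f₂.symm, f₁.trans f₂.symm]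
      rw [hside_bp v hp, hside_bp v hp, e]
      exact key p₂ p₂p₀ p₂p₁ p₂q₀ p₂q₁ b
    by_cases hq : v = q₀ ∨ v = q₁
    · have e : c v = c q₂ := by rcases hq with rfl | rfl <;> assumption
      rw [hside_bq v (.inr hq), hside_bq v (.inr hq), e]
      exact key q₂ p₀q₂.symm p₁q₂.symm q₂q₀ q₂q₁ b
    push Not at hp hq
    exact key v hp.1 hp.2 hq.1 hq.2 b
  choose g hgm hπg using hπ
  refine .of_relations (fun c c' => ∀ v, v ≠ q₀ → v ≠ q₁ → c' (φ v) = c v)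
    (fun R R' => ∀ r', r' ≠ m → R' r' = R (π r')) (fun c R h => ?_) (fun c' R' h => ?_)
    (fun f c c' h v hv₀ hv₁ => congrArg f (h v hv₀ hv₁))
    (fun c c₁ c₂ hc₁ hc₂ h₁ h₂ => ?_) (fun c c₁ c₂ hc₁ hc₂ h₁ h₂ => ?_)
    (fun c R R₁ R₂ hR₁ hR₂ h₁ h₂ => ?_) (fun c R R₁ R₂ hR₁ hR₂ h₁ h₂ => ?_)
    (fun c R c' R' h h' hc hR => ?_)
  · classical
    let c' : D'.V → X := fun v' =>
      if φ.symm v' = q₀ ∨ φ.symm v' = q₁ then signedOp (!s) (c q₂) (c p₀) else c (φ.symm v')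
    let R' : D'.Region → X := fun r' => if r' = m then signedOp (!s) (R Q) (c p₀) else R (π r')
    have hcc : ∀ v, v ≠ q₀ → v ≠ q₁ → c' (φ v) = c v := by
      intro v hv₀ hv₁
      simp [c', hv₀, hv₁]
    have hRR : ∀ r', r' ≠ m → R' r' = R (π r') := fun r' hr' => if_neg hr'
    have hc' : D'.IsArcColoring c' := harc c c' hcc h.arc (by simp [c']) (by simp [c'])
    refine ⟨c', R', ⟨hc', ?_, ?_⟩, hcc, hRR⟩
    · exact hregion c c' R R' hcc hRR h.arc hc' h.region (if_pos rfl)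
    · rw [hRR _ houterm, houter]
      exact h.outer
  · classical
    let c : D.V → X := fun v => if v = q₀ ∨ v = q₁ then c' (φ q₂) else c' (φ v)
    have hcc : ∀ v, v ≠ q₀ → v ≠ q₁ → c' (φ v) = c v := by
      intro v hv₀ hv₁
      simp [c, hv₀, hv₁]
    -- Both end regions are reached from `P'` across edges of the upper strand, which has one color.
    -- Hence `R'` descends along `π`.
    have hM : R' M₁ = R' M₂ := by
      have e₁ := h.region (φ (D.prev p₀)) (!s)
      have e₂ := h.region (φ p₂) (!s)
      rw [Bool.not_not, (hap₀ _ rfl).1, (hap₀ _ rfl).2, (hchain' _ h.arc).1] at e₁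
      rw [Bool.not_not, (hap₂ _ rfl).1, (hap₂ _ rfl).2, (hchain' _ h.arc).2.2.1] at e₂
      exact signedOp_left_injective (e₁.trans e₂.symm)
    have hRR : ∀ r', r' ≠ m → R' r' = R' (g (π r')) := by
      intro r' hr'
      rcases (hπeq r' (g (π r')) hr' (hgm _)).1 (hπg _).symm with e | ⟨e, e'⟩ | ⟨e, e'⟩
      · rw [← e]
      · rw [e', e, hM]
      · rw [e', e, hM]
    have hc : D.IsArcColoring c := harc' c c' hcc h.arc (by simp [c]) (by simp [c])
    refine ⟨c, fun r => R' (g r), ⟨hc, ?_, ?_⟩, hcc, hRR⟩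
    · exact hregion' c c' _ R' hcc hRR hc h.region
    · rw [← houter, ← hRR _ houterm]
      exact h.outer
  · funext v
    obtain ⟨v, rfl⟩ := φ.surjective v
    obtain ⟨-, -, -, e₁, f₁, -⟩ := hchain' c₁ hc₁
    obtain ⟨-, -, -, e₂, f₂, -⟩ := hchain' c₂ hc₂
    rw [h₁ _ prevq₀q₀ prevq₀q₁, h₁ _ p₀q₀ p₀q₁] at e₁ f₁
    rw [h₂ _ prevq₀q₀ prevq₀q₁, h₂ _ p₀q₀ p₀q₁] at e₂ f₂
    by_cases hv₀ : v = q₀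
    · rw [hv₀, e₁, e₂]
    by_cases hv₁ : v = q₁
    · rw [hv₁, f₁, f₂]
    rw [h₁ v hv₀ hv₁, h₂ v hv₀ hv₁]
  · funext v
    obtain ⟨-, -, -, e₁, f₁⟩ := hchain c₁ hc₁
    obtain ⟨-, -, -, e₂, f₂⟩ := hchain c₂ hc₂
    by_cases hv₀ : v = q₀
    · rw [hv₀, e₁, e₂, ← h₁ _ q₂q₀ q₂q₁, ← h₂ _ q₂q₀ q₂q₁]
    by_cases hv₁ : v = q₁
    · rw [hv₁, f₁, f₂, ← h₁ _ q₂q₀ q₂q₁, ← h₂ _ q₂q₀ q₂q₁]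
    rw [← h₁ v hv₀ hv₁, ← h₂ v hv₀ hv₁]
  · funext r
    by_cases hr : r = m
    · have e₁ := hR₁ (φ p₀) (!s)
      have e₂ := hR₂ (φ p₀) (!s)
      rw [Bool.not_not, (hap p₀ (.inl rfl)).1, (hap p₀ (.inl rfl)).2] at e₁ e₂
      rw [hr, ← e₁, ← e₂, h₁ _ hQ'm, h₂ _ hQ'm]
    · rw [h₁ r hr, h₂ r hr]
  · funext r
    rw [← hπg r, ← h₁ _ (hgm r), ← h₂ _ (hgm r)]
  · set N₀ : D.V × D.V × Bool := (o₀, q₀, !s) with hN₀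
    set N₂ : D.V × D.V × Bool := (o₂, q₂, s) with hN₂
    have himage : D'.signedCrossings = insert (mapCrossing φ N₀) (insert (mapCrossing φ N₂)
        (mapCrossing φ '' D.signedCrossings)) := by
      rw [← Set.image_insert_eq, ← Set.image_insert_eq]
      ext ⟨o, u, b⟩
      obtain ⟨o, rfl⟩ := φ.surjective o
      obtain ⟨u, rfl⟩ := φ.surjective u
      rw [show (φ o, φ u, b) = mapCrossing φ (o, u, b) from rfl,
        (mapCrossing_injective φ.injective).mem_set_image]
      simp only [Set.mem_insert_iff, hN₀, hN₂, Prod.mk.injEq]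
      refine (hcr o u b).trans ?_
      rw [or_comm, or_assoc]
      rfl
    have hnot₂ : mapCrossing φ N₂ ∉ mapCrossing φ '' D.signedCrossings := by
      rw [(mapCrossing_injective φ.injective).mem_set_image]
      exact fun hx => (hmark mq₂ (b := s) hx).2 rfl
    have hnot₀ : mapCrossing φ N₀ ∉
        insert (mapCrossing φ N₂) (mapCrossing φ '' D.signedCrossings) := by
      rw [← Set.image_insert_eq, (mapCrossing_injective φ.injective).mem_set_image]
      rintro (hx | hx)
      · exact q₂q₀ (congrArg (fun x => x.2.1) hx).symm
      · exact (hmark mq₀ (b := !s) hx).2 rfl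
    rw [himage, finsum_mem_insert _ hnot₀ (Set.toFinite _),
      finsum_mem_insert _ hnot₂ (Set.toFinite _),
      finsum_localWeight_image (c := c) (R := R) φ.injective]
    · obtain ⟨-, f₁, f₂, f₃, f₄, f₅⟩ := hchain' c' h'.arc
      have eo : c' (φ o₀) = c' (φ o₂) := by
        rcases ho with ⟨rfl, rfl⟩ | ⟨rfl, rfl⟩ <;> simp [f₂]
      have hsq : ∀ b, D'.side (φ q₀) b = D'.side (φ q₁) b := by
        intro b
        have e₀ := haq q₀ (.inl rfl)
        have e₁ := haq q₁ (.inr rfl)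
        rcases Bool.eq_or_eq_not b t with rfl | rfl
        · rw [e₀.1, e₁.1]
        · rw [e₀.2, e₁.2]
      -- Only the colors are compared: the regions themselves may be the two different end regions
      -- `M₁` and `M₂`.
      have hsq' : R' (D'.side (φ (D.prev q₀)) false) = R' (D'.side (φ q₂) false) := by
        rw [hR _ (hside_prevq₀ _).1, hR _ (hside_q₂ _).1, (hside_prevq₀ _).2, (hside_q₂ _).2,
          hside_bq _ (.inl rfl)]
      -- The right under-edges are `prev q₀` and `q₂` if `s = false`, and `q₀` and `q₁` if `s =
      -- true`. In each case they have equal colors and equally colored right sides, while the signs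
      -- are opposite.
      have hzero : D'.localWeight θ c' R' (mapCrossing φ N₀) +
          D'.localWeight θ c' R' (mapCrossing φ N₂) = 0 := by
        cases s
        · simp [hN₀, hN₂, localWeight, mapCrossing, rightEdge, hprev, f₅, hsq', eo]
        · simp [hN₀, hN₂, localWeight, mapCrossing, rightEdge, hprev, hprev_q₂, f₃, f₄, hsq, eo]
      rw [← add_assoc, hzero, zero_add]
    · intro o u b hx
      have hp : ∀ {v}, D.IsMark (D.next v) → D.prev u ≠ v :=
        fun hv => hprevne (hmark hv hx).2
      have hs := hside u (hmark mp₀ hx).2 (hmark mp₁ hx).2 (hmark mq₀ hx).2 (hmark mq₁ hx).2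
      have hsp := hside (D.prev u) (hp (hp₁ ▸ mp₁)) (hp (hp₂ ▸ mp₂)) (hp (hq₁ ▸ mq₁))
        (hp (hq₂ ▸ mq₂))
      refine localWeight_eq (hc o (hmark mq₀ hx).1 (hmark mq₁ hx).1)
        (hc u (hmark mq₀ hx).2 (hmark mq₁ hx).2) ?_ ?_ ?_
      · rw [hprev, hc _ (hp (hq₁ ▸ mq₁)) (hp (hq₂ ▸ mq₂))]
      · rw [hR _ (hs _).1, (hs _).2]
      · rw [hprev, hR _ (hsp _).1, (hsp _).2]

end ReidemeisterTwo

/-! ### Combinatorics and arc colorings at a triangle. -/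

section Triangle

theorem endpoint_or_not (D : LinkDiagram) (v : D.V) (a b : Bool) :
    D.endpoint v a = D.endpoint v b ∨ D.endpoint v a = D.endpoint v (!b) := by
  rcases Bool.eq_or_eq_not a b with rfl | rfl <;> simp

theorem endpoint_not_ne {D : LinkDiagram} (v : D.V) (a : Bool) :
    D.endpoint v a ≠ D.endpoint v (!a) := by
  cases a
  · exact next_ne v
  · exact (next_ne v).symm

theorem not_isCrossing_endpoint {D : LinkDiagram} (v : D.V) (a b : Bool) :
    ¬ D.IsCrossing (D.endpoint v a) (D.endpoint v b) := by
  intro h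
  cases a <;> cases b
  exacts [h.1 rfl, D.pos_next_ne v h.2.1, D.pos_next_ne v h.2.1.symm, h.1 rfl]

theorem exists_endpoint_of_neighbor_eq {D : LinkDiagram} {v w : D.V} {a : Bool}
    (h : D.neighbor v a = w) : ∃ b, D.endpoint v a = D.endpoint w b := by
  subst h
  cases a
  · exact ⟨true, rfl⟩
  · exact ⟨false, (next_prev v).symm⟩

theorem neighbor_ne_self {D : LinkDiagram} (v : D.V) (a : Bool) : D.neighbor v a ≠ v := by
  cases a
  · exact next_ne v
  · exact fun h => next_ne (D.prev v) ((next_prev v).trans h.symm)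

theorem map_endpoint {D D' : LinkDiagram} {φ : D.V → D'.V}
    (h : ∀ v, φ (D.next v) = D'.next (φ v)) (v : D.V) (a : Bool) :
    D'.endpoint (φ v) a = φ (D.endpoint v a) := by
  cases a
  · exact (h v).symm
  · rfl

theorem map_neighbor {D D' : LinkDiagram} {φ : D.V → D'.V}
    (h : ∀ v, φ (D.next v) = D'.next (φ v)) (v : D.V) (a : Bool) :
    D'.neighbor (φ v) a = φ (D.neighbor v a) := by
  cases a
  · exact (h v).symm
  · exact map_prev h v

theorem rightEdge_endpoint (D : LinkDiagram) (v : D.V) (a b : Bool) :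
    D.rightEdge (D.endpoint v a) b = if b == a then D.neighbor v a else v := by
  cases a <;> cases b <;> simp [rightEdge, endpoint, neighbor]

theorem apply_neighbor_eq_iff {D : LinkDiagram} {X : Type*} (c : D.V → X) (v : D.V) (a : Bool) :
    c (D.neighbor v a) = c v ↔ c (D.prev (D.endpoint v a)) = c (D.endpoint v a) := by
  cases a
  · simp [endpoint, neighbor, eq_comm]
  · rfl

theorem apply_endpoint_eq {D : LinkDiagram} {X : Type*} {c : D.V → X} {v : D.V} {a : Bool}
    (h : c (D.neighbor v a) = c v) : c (D.endpoint v a) = c v := by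
  cases a
  · exact h
  · rfl

/-- Translates a crossing rule stated along the orientation into one that goes from the prolongation
to the edge itself. At a first end point the two directions agree; at a second end point they are
opposite and the sign is inverted. -/
theorem signedOp_neighbor_iff {D : LinkDiagram} {X : Type*} [Quandle X] (c : D.V → X) (v : D.V)
    (a b : Bool) (z : X) : signedOp (b == a) (c (D.neighbor v a)) z = c v ↔
      signedOp b (c (D.prev (D.endpoint v a))) z = c (D.endpoint v a) := by
  cases a
  · rw [signedOp_eq_iff]
    simp [endpoint, neighbor]
  · simp [endpoint, neighbor]

/-- The content of `LinkDiagram.TriangleAt` with the regions around the triangle named. -/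
structure Triangle (D : LinkDiagram) (p q r : D.V) (α β γ o sp sq sr : Bool)
    (T Rp Rq Rr RX RY RZ : D.Region) : Prop where
  sp_eq : sp = (o == !α)
  sq_eq : sq = (o == β)
  sr_eq : sr = (o == γ)
  crossing_X : D.IsSignedCrossing (D.endpoint p α) (D.endpoint q β) (o == (sp == sq))
  crossing_Y : D.IsSignedCrossing (D.endpoint q (!β)) (D.endpoint r γ) (o == (sq == sr))
  crossing_Z : D.IsSignedCrossing (D.endpoint p (!α)) (D.endpoint r (!γ)) (o != (sp == sr))
  side_p : D.side p sp = T
  side_p' : D.side p (!sp) = Rp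
  side_q : D.side q sq = T
  side_q' : D.side q (!sq) = Rq
  side_r : D.side r sr = T
  side_r' : D.side r (!sr) = Rr
  side_pX : D.side (D.neighbor p α) sp = Rq
  side_pX' : D.side (D.neighbor p α) (!sp) = RX
  side_qX : D.side (D.neighbor q β) sq = Rp
  side_qX' : D.side (D.neighbor q β) (!sq) = RX
  side_qY : D.side (D.neighbor q (!β)) sq = Rr
  side_qY' : D.side (D.neighbor q (!β)) (!sq) = RY
  side_rY : D.side (D.neighbor r γ) sr = Rq
  side_rY' : D.side (D.neighbor r γ) (!sr) = RY
  side_rZ : D.side (D.neighbor r (!γ)) sr = Rp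
  side_rZ' : D.side (D.neighbor r (!γ)) (!sr) = RZ
  side_pZ : D.side (D.neighbor p (!α)) sp = Rr
  side_pZ' : D.side (D.neighbor p (!α)) (!sp) = RZ
  ne_outer : T ≠ D.outer
  side_ne : ∀ v, v ≠ p → v ≠ q → v ≠ r → ∀ b, D.side v b ≠ T

theorem TriangleAt.exists_triangle {D : LinkDiagram} {p q r : D.V} {α β γ o : Bool}
    {T : D.Region} (h : D.TriangleAt p q r α β γ o T) :
    ∃ sp sq sr Rp Rq Rr RX RY RZ, D.Triangle p q r α β γ o sp sq sr T Rp Rq Rr RX RY RZ := by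
  obtain ⟨sp, sq, sr, Rp, Rq, Rr, RX, RY, RZ, h1, h2, h3, h4, h5, h6, h7, h8, h9, h10, h11, h12,
    h13, h14, h15, h16, h17, h18, h19, h20, h21, h22, h23, h24, h25, h26⟩ := h
  exact ⟨sp, sq, sr, Rp, Rq, Rr, RX, RY, RZ, h1, h2, h3, h4, h5, h6, h7, h8, h9, h10, h11, h12,
    h13, h14, h15, h16, h17, h18, h19, h20, h21, h22, h23, h24, h25, h26⟩

/-- `v` is a corner of the triangle with the sides `p`, `q`, `r`, on one of the two strands. -/
def IsTriangleVertex (D : LinkDiagram) (p q r v : D.V) : Prop :=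
  ∃ w a, (w = p ∨ w = q ∨ w = r) ∧ v = D.endpoint w a

theorem ne_of_not_isTriangleVertex {D : LinkDiagram} {p q r v w : D.V}
    (h : ¬ D.IsTriangleVertex p q r v) (hw : w = p ∨ w = q ∨ w = r) :
    v ≠ w ∧ v ≠ D.next w ∧ D.prev v ≠ w := by
  refine ⟨fun e => h ⟨w, true, hw, e⟩, fun e => h ⟨w, false, hw, e⟩, fun e => h ⟨w, false, hw, ?_⟩⟩
  rw [← e]
  exact (next_prev v).symm

theorem isTriangleVertex_map {D D' : LinkDiagram} (φ : D.V ≃ D'.V)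
    (h : ∀ v, φ (D.next v) = D'.next (φ v)) (p q r v : D.V) :
    D'.IsTriangleVertex (φ p) (φ q) (φ r) (φ v) ↔ D.IsTriangleVertex p q r v := by
  simp only [IsTriangleVertex, φ.surjective.exists, φ.injective.eq_iff, map_endpoint h]

/-- The conditions on an arc coloring at the corners of a triangle. -/
structure TriangleArcs {X : Type*} [Quandle X] (D : LinkDiagram) (p q r : D.V)
    (α β γ sp sq : Bool) (c : D.V → X) : Prop where
  pX : c (D.neighbor p α) = c p
  pZ : c (D.neighbor p (!α)) = c p
  qY : c (D.neighbor q (!β)) = c q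
  qX : signedOp sp (c (D.neighbor q β)) (c p) = c q
  rY : signedOp sq (c (D.neighbor r γ)) (c q) = c r
  rZ : signedOp sp (c (D.neighbor r (!γ))) (c p) = c r

namespace Triangle

variable {D : LinkDiagram} {p q r : D.V} {α β γ o sp sq sr : Bool}
  {T Rp Rq Rr RX RY RZ : D.Region}

/-- The three sides have no vertex in common. The ends of `p` are over-passages, those of `r` are
under-passages, and `q` has one of each; a coincidence would make a vertex both over and under, a
crossing between the ends of one edge, or two ends of one edge equal. -/
theorem eq_of_endpoint_eq (h : D.Triangle p q r α β γ o sp sq sr T Rp Rq Rr RX RY RZ) {v w : D.V}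
    {a b : Bool} (hv : v = p ∨ v = q ∨ v = r) (hw : w = p ∨ w = q ∨ w = r)
    (e : D.endpoint v a = D.endpoint w b) : v = w := by
  have hX := h.crossing_X.1
  have hY := h.crossing_Y.1
  have hZ := h.crossing_Z.1
  have hqq : ∀ a b, ¬ D.IsCrossing (D.endpoint q a) (D.endpoint q b) :=
    not_isCrossing_endpoint q
  have hpq : ∀ a b, D.endpoint p a ≠ D.endpoint q b := by
    intro a b e
    rcases D.endpoint_or_not q b β with e' | e' <;> rw [e'] at e
    · rcases D.endpoint_or_not p a α with f | f <;> rw [f] at e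
      · exact hX.1 e
      · rw [e] at hZ
        exact hX.not_over hZ
    · rcases D.endpoint_or_not p a α with f | f <;> rw [f] at e
      · rw [e] at hX
        exact hqq _ _ hX
      · rw [e] at hZ
        exact endpoint_not_ne r γ (hY.under_unique hZ)
  have hpr : ∀ a b, D.endpoint p a ≠ D.endpoint r b := by
    intro a b e
    rcases D.endpoint_or_not p a α with f | f <;>
      rcases D.endpoint_or_not r b γ with g | g <;> rw [f, g] at e
    · exact hY.not_over (e ▸ hX)
    · exact hZ.not_over (e ▸ hX)
    · exact hY.not_over (e ▸ hZ)
    · exact hZ.1 e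
  have hqr : ∀ a b, D.endpoint q a ≠ D.endpoint r b := by
    intro a b e
    rcases D.endpoint_or_not q a β with f | f <;>
      rcases D.endpoint_or_not r b γ with g | g <;> rw [f, g] at e
    · rw [← e] at hY
      exact hqq _ _ hY
    · rw [← e] at hZ
      exact endpoint_not_ne p α (hX.over_unique hZ)
    · exact hY.1 e
    · exact hZ.not_over (e ▸ hY)
  rcases hv with rfl | rfl | rfl <;> rcases hw with rfl | rfl | rfl
  exacts [rfl, (hpq _ _ e).elim, (hpr _ _ e).elim, (hpq _ _ e.symm).elim, rfl,
    (hqr _ _ e).elim, (hpr _ _ e.symm).elim, (hqr _ _ e.symm).elim, rfl]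

/-- Places the prolongations of the sides outside the disk, where edges are unchanged by the move.
-/
theorem neighbor_ne (h : D.Triangle p q r α β γ o sp sq sr T Rp Rq Rr RX RY RZ) {v w : D.V}
    (hv : v = p ∨ v = q ∨ v = r) (hw : w = p ∨ w = q ∨ w = r) (a : Bool) :
    D.neighbor v a ≠ w := by
  intro e
  obtain ⟨b, hb⟩ := exists_endpoint_of_neighbor_eq e
  have := h.eq_of_endpoint_eq hv hw hb
  exact neighbor_ne_self v a (e.trans this.symm)

theorem side_neighbor_ne (h : D.Triangle p q r α β γ o sp sq sr T Rp Rq Rr RX RY RZ) {v : D.V}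
    (hv : v = p ∨ v = q ∨ v = r) (a b : Bool) : D.side (D.neighbor v a) b ≠ T :=
  h.side_ne _ (h.neighbor_ne hv (.inl rfl) a) (h.neighbor_ne hv (.inr (.inl rfl)) a)
    (h.neighbor_ne hv (.inr (.inr rfl)) a) b

theorem p_ne_q (h : D.Triangle p q r α β γ o sp sq sr T Rp Rq Rr RX RY RZ) : p ≠ q := by
  rintro rfl
  exact not_isCrossing_endpoint _ _ _ h.crossing_X.1

theorem p_ne_r (h : D.Triangle p q r α β γ o sp sq sr T Rp Rq Rr RX RY RZ) : p ≠ r := by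
  rintro rfl
  exact not_isCrossing_endpoint _ _ _ h.crossing_Z.1

theorem q_ne_r (h : D.Triangle p q r α β γ o sp sq sr T Rp Rq Rr RX RY RZ) : q ≠ r := by
  rintro rfl
  exact not_isCrossing_endpoint _ _ _ h.crossing_Y.1

theorem eq_of_isCrossing (h : D.Triangle p q r α β γ o sp sq sr T Rp Rq Rr RX RY RZ)
    {x y : D.V} (hxy : D.IsCrossing x y)
    (hv : D.IsTriangleVertex p q r x ∨ D.IsTriangleVertex p q r y) :
    (x = D.endpoint p α ∧ y = D.endpoint q β) ∨
    (x = D.endpoint q (!β) ∧ y = D.endpoint r γ) ∨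
    (x = D.endpoint p (!α) ∧ y = D.endpoint r (!γ)) := by
  have hX := h.crossing_X.1
  have hY := h.crossing_Y.1
  have hZ := h.crossing_Z.1
  rcases hv with ⟨w, a, rfl | rfl | rfl, rfl⟩ | ⟨w, a, rfl | rfl | rfl, rfl⟩
  · rcases D.endpoint_or_not w a α with f | f <;> rw [f] at hxy ⊢
    · exact .inl ⟨rfl, hxy.under_unique hX⟩
    · exact .inr (.inr ⟨rfl, hxy.under_unique hZ⟩)
  · rcases D.endpoint_or_not w a β with f | f <;> rw [f] at hxy ⊢
    · exact absurd hxy hX.not_over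
    · exact .inr (.inl ⟨rfl, hxy.under_unique hY⟩)
  · rcases D.endpoint_or_not w a γ with f | f <;> rw [f] at hxy ⊢
    · exact absurd hxy hY.not_over
    · exact absurd hxy hZ.not_over
  · rcases D.endpoint_or_not w a α with f | f <;> rw [f] at hxy ⊢
    · exact absurd hxy hX.not_under
    · exact absurd hxy hZ.not_under
  · rcases D.endpoint_or_not w a β with f | f <;> rw [f] at hxy ⊢
    · exact .inl ⟨hxy.over_unique hX, rfl⟩
    · exact absurd hxy hY.not_under
  · rcases D.endpoint_or_not w a γ with f | f <;> rw [f] at hxy ⊢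
    · exact .inr (.inl ⟨hxy.over_unique hY, rfl⟩)
    · exact .inr (.inr ⟨hxy.over_unique hZ, rfl⟩)

theorem isTriangleVertex_iff (h : D.Triangle p q r α β γ o sp sq sr T Rp Rq Rr RX RY RZ)
    {x y : D.V} (hxy : D.IsCrossing x y) :
    D.IsTriangleVertex p q r x ↔ D.IsTriangleVertex p q r y := by
  constructor <;> intro hv
  · rcases h.eq_of_isCrossing hxy (.inl hv) with ⟨-, rfl⟩ | ⟨-, rfl⟩ | ⟨-, rfl⟩
    exacts [⟨q, _, by simp, rfl⟩, ⟨r, _, by simp, rfl⟩, ⟨r, _, by simp, rfl⟩]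
  · rcases h.eq_of_isCrossing hxy (.inr hv) with ⟨rfl, -⟩ | ⟨rfl, -⟩ | ⟨rfl, -⟩
    exacts [⟨p, _, by simp, rfl⟩, ⟨q, _, by simp, rfl⟩, ⟨p, _, by simp, rfl⟩]

/-- Going from the prolongation of `q` to `q` means crossing `p` towards the triangle, that is,
towards the side `sp`. The sign of the crossing and the orientation of `q` combine to exactly this.
-/
theorem sign_X (h : D.Triangle p q r α β γ o sp sq sr T Rp Rq Rr RX RY RZ) :
    ((o == (sp == sq)) == β) = sp := by
  rw [h.sq_eq]
  revert sp; cases o <;> cases β <;> simp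

theorem sign_Y (h : D.Triangle p q r α β γ o sp sq sr T Rp Rq Rr RX RY RZ) :
    ((o == (sq == sr)) == γ) = sq := by
  rw [h.sr_eq]
  revert sq; cases o <;> cases γ <;> simp

theorem sign_Z (h : D.Triangle p q r α β γ o sp sq sr T Rp Rq Rr RX RY RZ) :
    ((o != (sp == sr)) == !γ) = sp := by
  rw [h.sr_eq]
  revert sp; cases o <;> cases γ <;> simp

section Arcs

variable {X : Type*} [Quandle X] {c : D.V → X}

theorem triangleArcs (h : D.Triangle p q r α β γ o sp sq sr T Rp Rq Rr RX RY RZ)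
    (hc : D.IsArcColoring c) : D.TriangleArcs p q r α β γ sp sq c := by
  have hX := h.crossing_X
  have hY := h.crossing_Y
  have hZ := h.crossing_Z
  have pX : c (D.neighbor p α) = c p := (apply_neighbor_eq_iff c p α).2
    (hc.eq_of_not_under _ fun ⟨_, hx⟩ => hX.1.not_under hx)
  have pZ : c (D.neighbor p (!α)) = c p := (apply_neighbor_eq_iff c p (!α)).2
    (hc.eq_of_not_under _ fun ⟨_, hx⟩ => hZ.1.not_under hx)
  have qY : c (D.neighbor q (!β)) = c q := (apply_neighbor_eq_iff c q (!β)).2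
    (hc.eq_of_not_under _ fun ⟨_, hx⟩ => hY.1.not_under hx)
  refine ⟨pX, pZ, qY, ?_, ?_, ?_⟩
  · have := (signedOp_neighbor_iff c q β _ _).2 (hc.crossing _ _ _ hX)
    rwa [h.sign_X, apply_endpoint_eq pX] at this
  · have := (signedOp_neighbor_iff c r γ _ _).2 (hc.crossing _ _ _ hY)
    rwa [h.sign_Y, apply_endpoint_eq qY] at this
  · have := (signedOp_neighbor_iff c r (!γ) _ _).2 (hc.crossing _ _ _ hZ)
    rwa [h.sign_Z, apply_endpoint_eq pZ] at this

theorem isArcColoring (h : D.Triangle p q r α β γ o sp sq sr T Rp Rq Rr RX RY RZ)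
    (hc : D.TriangleArcs p q r α β γ sp sq c)
    (h₁ : ∀ v, ¬ D.IsTriangleVertex p q r v → (¬ ∃ o, D.IsCrossing o v) → c (D.prev v) = c v)
    (h₂ : ∀ o u b, ¬ D.IsTriangleVertex p q r o → ¬ D.IsTriangleVertex p q r u →
      D.IsSignedCrossing o u b → signedOp b (c (D.prev u)) (c o) = c u) :
    D.IsArcColoring c := by
  have hX := h.crossing_X
  have hY := h.crossing_Y
  have hZ := h.crossing_Z
  refine ⟨fun v hv => ?_, fun x u b hb => ?_⟩
  · by_cases hvt : D.IsTriangleVertex p q r v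
    · obtain ⟨w, a, rfl | rfl | rfl, rfl⟩ := hvt
      · rcases D.endpoint_or_not w a α with f | f <;> rw [f] at hv ⊢
        · exact (apply_neighbor_eq_iff c w _).1 hc.pX
        · exact (apply_neighbor_eq_iff c w _).1 hc.pZ
      · rcases D.endpoint_or_not w a β with f | f <;> rw [f] at hv ⊢
        · exact absurd ⟨_, hX.1⟩ hv
        · exact (apply_neighbor_eq_iff c w _).1 hc.qY
      · rcases D.endpoint_or_not w a γ with f | f <;> rw [f] at hv ⊢
        · exact absurd ⟨_, hY.1⟩ hv
        · exact absurd ⟨_, hZ.1⟩ hv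
    · exact h₁ v hvt hv
  · by_cases hx : D.IsTriangleVertex p q r x
    · rcases h.eq_of_isCrossing hb.1 (.inl hx) with ⟨rfl, rfl⟩ | ⟨rfl, rfl⟩ | ⟨rfl, rfl⟩
      · rw [hb.sign_unique hX, ← signedOp_neighbor_iff, h.sign_X, apply_endpoint_eq hc.pX]
        exact hc.qX
      · rw [hb.sign_unique hY, ← signedOp_neighbor_iff, h.sign_Y, apply_endpoint_eq hc.qY]
        exact hc.rY
      · rw [hb.sign_unique hZ, ← signedOp_neighbor_iff, h.sign_Z, apply_endpoint_eq hc.pZ]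
        exact hc.rZ
    · exact h₂ x u b hx ((h.isTriangleVertex_iff hb.1).not.1 hx) hb

end Arcs

end Triangle

end Triangle

/-! ### The cocycle identity at a triangle. -/

section TriangleWeight

/-- The contribution of the three crossings at the corners of a triangle to the weight, when the
top strand has the color `z`, the middle strand has the colors `y₀` and `y₁`, and the bottom strand
has the colors `w` (on the triangle), `w₁` and `w₂`. -/
def triangleWeight {X A : Type*} [AddCommGroup A] (θ : X → X → X → A) (o sp sq sr : Bool)
    (T Rp Rq Rr RX RY RZ z y₀ y₁ w w₁ w₂ : X) : A :=
  (if o == (sp == sq) then (1 : ℤ) else -1) •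
    θ (if sp then (if sq then RX else Rp) else (if sq then Rq else T))
      (if sp then y₀ else y₁) z +
  ((if o == (sq == sr) then (1 : ℤ) else -1) •
    θ (if sq then (if sr then RY else Rq) else (if sr then Rr else T))
      (if sq then w₁ else w) y₁ +
  (if o != (sp == sr) then (1 : ℤ) else -1) •
    θ (if sp then (if sr then RZ else Rp) else (if sr then Rr else T))
      (if sp then w₂ else w) z)

/-- For each choice of sides, some region before or after the move lies on the right of all three
strands. The cocycle identity is applied to its color and to the colors of the bottom, middle and
top strands there; the eight cases differ in which region this is. -/
theorem triangleWeight_eq {X A : Type*} [Quandle X] [AddCommGroup A]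
    {θ : X → X → X → A} (hθ : IsQuandleThreeCocycle θ) (o sp sq sr : Bool)
    {T T' Rp Rq Rr RX RY RZ z y₀ y₁ w w' w₁ w₂ : X}
    (h₁ : signedOp sp Rp z = T) (h₂ : signedOp sp RX z = Rq) (h₃ : signedOp sp RZ z = Rr)
    (h₄ : signedOp (!sp) RY z = T')
    (h₅ : signedOp sq Rq y₁ = T) (h₆ : signedOp sq RY y₁ = Rr) (h₇ : signedOp sq RX y₀ = Rp)
    (h₈ : signedOp (!sq) RZ y₀ = T')
    (h₉ : signedOp sr Rr w = T) (h₁₀ : signedOp sr RY w₁ = Rq) (h₁₁ : signedOp sr RZ w₂ = Rp)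
    (h₁₂ : signedOp (!sr) RX w' = T')
    (h₁₃ : signedOp sp y₀ z = y₁) (h₁₄ : signedOp sq w₁ y₁ = w) (h₁₅ : signedOp sp w₂ z = w)
    (h₁₆ : signedOp (!sq) w₂ y₀ = w') (h₁₇ : signedOp (!sp) w₁ z = w') :
    triangleWeight θ o sp sq sr T Rp Rq Rr RX RY RZ z y₀ y₁ w w₁ w₂ =
      triangleWeight θ o (!sp) (!sq) (!sr) T' RY RZ RX Rr Rp Rq z y₁ y₀ w' w₂ w₁ := by
  -- All hypotheses are turned into forward operations, so that they rewrite the translated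
  -- arguments of the cocycle identity.
  have hf : ∀ x y t : X, signedOp false x y = t ↔ signedOp true t y = x :=
    fun x y t => signedOp_eq_iff
  have hcoc : ∀ x y t v, _ := hθ.cocycle
  have hop : ∀ x y : X, quandleOp x y = signedOp true x y := fun _ _ => rfl
  simp only [hop] at hcoc
  -- Changing `o` reverses all six signs, hence the choice between the identity and its negative.
  cases sp <;> cases sq <;> cases sr <;> simp only [Bool.not_true, Bool.not_false, hf] at *
  · have := hcoc T w y₁ z
    simp only [*] at this
    cases o <;> simp [triangleWeight] <;>
      first
      | linear_combination (norm := module) this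
      | linear_combination (norm := module) (-1 : ℤ) • this
  · have := hcoc Rr w y₁ z
    simp only [*] at this
    cases o <;> simp [triangleWeight] <;>
      first
      | linear_combination (norm := module) this
      | linear_combination (norm := module) (-1 : ℤ) • this
  · have := hcoc Rq w₁ y₁ z
    simp only [*] at this
    cases o <;> simp [triangleWeight] <;>
      first
      | linear_combination (norm := module) this
      | linear_combination (norm := module) (-1 : ℤ) • this
  · have := hcoc RY w₁ y₁ z
    simp only [*] at this
    cases o <;> simp [triangleWeight] <;>
      first
      | linear_combination (norm := module) this
      | linear_combination (norm := module) (-1 : ℤ) • this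
  · have := hcoc Rp w₂ y₀ z
    simp only [*] at this
    cases o <;> simp [triangleWeight] <;>
      first
      | linear_combination (norm := module) this
      | linear_combination (norm := module) (-1 : ℤ) • this
  · have := hcoc RZ w₂ y₀ z
    simp only [*] at this
    cases o <;> simp [triangleWeight] <;>
      first
      | linear_combination (norm := module) this
      | linear_combination (norm := module) (-1 : ℤ) • this
  · have := hcoc RX w' y₀ z
    simp only [*] at this
    cases o <;> simp [triangleWeight] <;>
      first
      | linear_combination (norm := module) this
      | linear_combination (norm := module) (-1 : ℤ) • this
  · have := hcoc T' w' y₀ z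
    simp only [*] at this
    cases o <;> simp [triangleWeight] <;>
      first
      | linear_combination (norm := module) this
      | linear_combination (norm := module) (-1 : ℤ) • this

end TriangleWeight

/-! ### The weight of a diagram split at a triangle. -/

section TriangleLocalWeight

variable {X A : Type*} [Quandle X] [AddCommGroup A] {θ : X → X → X → A} {D : LinkDiagram}
  {p q r : D.V} {α β γ o sp sq sr : Bool} {T Rp Rq Rr RX RY RZ : D.Region}

theorem Triangle.finsum_localWeight (h : D.Triangle p q r α β γ o sp sq sr T Rp Rq Rr RX RY RZ)
    {c : D.V → X} (hc : D.TriangleArcs p q r α β γ sp sq c) (R : D.Region → X) :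
    ∑ᶠ x ∈ D.signedCrossings, D.localWeight θ c R x =
      triangleWeight θ o sp sq sr (R T) (R Rp) (R Rq) (R Rr) (R RX) (R RY) (R RZ) (c p)
        (c (D.neighbor q β)) (c q) (c r) (c (D.neighbor r γ)) (c (D.neighbor r (!γ))) +
      ∑ᶠ x ∈ {x | x ∈ D.signedCrossings ∧ ¬ D.IsTriangleVertex p q r x.1},
        D.localWeight θ c R x := by
  set NX : D.V × D.V × Bool := (D.endpoint p α, D.endpoint q β, o == (sp == sq)) with hNX
  set NY : D.V × D.V × Bool := (D.endpoint q (!β), D.endpoint r γ, o == (sq == sr)) with hNY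
  set NZ : D.V × D.V × Bool := (D.endpoint p (!α), D.endpoint r (!γ), o != (sp == sr)) with hNZ
  set O := {x | x ∈ D.signedCrossings ∧ ¬ D.IsTriangleVertex p q r x.1} with hO
  have hset : D.signedCrossings = insert NX (insert NY (insert NZ O)) := by
    ext ⟨x, y, b⟩
    constructor
    · intro hx
      by_cases hv : D.IsTriangleVertex p q r x
      · have hx' : D.IsSignedCrossing x y b := hx
        rcases h.eq_of_isCrossing hx'.1 (.inl hv) with ⟨rfl, rfl⟩ | ⟨rfl, rfl⟩ | ⟨rfl, rfl⟩
        · left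
          rw [hNX, hx'.sign_unique h.crossing_X]
        · right; left
          rw [hNY, hx'.sign_unique h.crossing_Y]
        · right; right; left
          rw [hNZ, hx'.sign_unique h.crossing_Z]
      · exact .inr (.inr (.inr ⟨hx, hv⟩))
    · rintro (hx | hx | hx | hx)
      · rw [hx]; exact h.crossing_X
      · rw [hx]; exact h.crossing_Y
      · rw [hx]; exact h.crossing_Z
      · exact hx.1
  have hYX : D.endpoint q β ≠ D.endpoint r γ :=
    fun e => h.q_ne_r (h.eq_of_endpoint_eq (by simp) (by simp) e)
  have hZX : D.endpoint q β ≠ D.endpoint r (!γ) :=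
    fun e => h.q_ne_r (h.eq_of_endpoint_eq (by simp) (by simp) e)
  have hX : NX ∉ insert NY (insert NZ O) := by
    rintro (e | e | e)
    · exact hYX (congrArg (fun x => x.2.1) e)
    · exact hZX (congrArg (fun x => x.2.1) e)
    · exact e.2 ⟨p, α, by simp, rfl⟩
  have hY : NY ∉ insert NZ O := by
    rintro (e | e)
    · exact endpoint_not_ne r γ (congrArg (fun x => x.2.1) e)
    · exact e.2 ⟨q, !β, by simp, rfl⟩
  have hZ : NZ ∉ O := fun e => e.2 ⟨p, !α, by simp, rfl⟩
  rw [hset, finsum_mem_insert _ hX (Set.toFinite _), finsum_mem_insert _ hY (Set.toFinite _),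
    finsum_mem_insert _ hZ (Set.toFinite _), triangleWeight, ← add_assoc, ← add_assoc,
    ← add_assoc]
  have h₃ := h.side_q
  have h₄ := h.side_q'
  have h₅ := h.side_r
  have h₆ := h.side_r'
  have h₇ := h.side_qX
  have h₈ := h.side_qX'
  have h₉ := h.side_rY
  have h₁₀ := h.side_rY'
  have h₁₁ := h.side_rZ
  have h₁₂ := h.side_rZ'
  congr 1
  congr 1
  congr 1
  · simp only [localWeight, hNX, rightEdge_endpoint, h.sign_X, apply_endpoint_eq hc.pX]
    cases sp <;> cases sq <;>
      simp only [Bool.not_true, Bool.not_false] at h₄ h₈ <;>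
      simp [h₃, h₄, h₇, h₈]
  · simp only [localWeight, hNY, rightEdge_endpoint, h.sign_Y, apply_endpoint_eq hc.qY]
    cases sq <;> cases sr <;>
      simp only [Bool.not_true, Bool.not_false] at h₆ h₁₀ <;>
      simp [h₅, h₆, h₉, h₁₀]
  · simp only [localWeight, hNZ, rightEdge_endpoint, h.sign_Z, apply_endpoint_eq hc.pZ]
    cases sp <;> cases sr <;>
      simp only [Bool.not_true, Bool.not_false] at h₆ h₁₂ <;>
      simp [h₅, h₆, h₁₁, h₁₂]

end TriangleLocalWeight

/-! ### The third Reidemeister move. -/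

section ReidemeisterThree

/-- The content of `LinkDiagram.ReidemeisterThree` with all the data named. -/
structure IsReidemeisterThree (D D' : LinkDiagram) (φ : D.V ≃ D'.V) (ψ : D.Region ≃ D'.Region)
    (p q r : D.V) (α β γ o sp sq sr : Bool) (T Rp Rq Rr RX RY RZ : D.Region) : Prop where
  next : ∀ v, φ (D.next v) = D'.next (φ v)
  before : D.Triangle p q r α β γ o sp sq sr T Rp Rq Rr RX RY RZ
  after : D'.Triangle (φ p) (φ q) (φ r) (!α) (!β) (!γ) o (!sp) (!sq) (!sr)
    (ψ T) (ψ RY) (ψ RZ) (ψ RX) (ψ Rr) (ψ Rp) (ψ Rq)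
  crossing : ∀ v, ¬ D.IsTriangleVertex p q r v →
    ∀ u b, D'.IsSignedCrossing (φ v) (φ u) b ↔ D.IsSignedCrossing v u b
  side : ∀ v, v ≠ p → v ≠ q → v ≠ r → ∀ b, D'.side (φ v) b = ψ (D.side v b)
  outer : ψ D.outer = D'.outer

variable {D D' : LinkDiagram}

/-- The prolongations lie outside the disk and `ψ` matches their sides, so the names of the
surrounding regions after the move are determined: each region opposite to a side becomes opposite
to a corner and vice versa. -/
theorem ReidemeisterThree.exists_data (h : ReidemeisterThree D D') :
    ∃ φ ψ p q r α β γ o sp sq sr T Rp Rq Rr RX RY RZ,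
      IsReidemeisterThree D D' φ ψ p q r α β γ o sp sq sr T Rp Rq Rr RX RY RZ := by
  obtain ⟨φ, ψ, p, q, r, α, β, γ, o, T, hnext, hT, hT', hcr, hside, houter⟩ := h
  obtain ⟨sp, sq, sr, Rp, Rq, Rr, RX, RY, RZ, h⟩ := hT.exists_triangle
  obtain ⟨sp', sq', sr', Rp', Rq', Rr', RX', RY', RZ', h'⟩ := hT'.exists_triangle
  have hsp : sp' = !sp := by rw [h'.sp_eq, h.sp_eq]; cases o <;> cases α <;> rfl
  have hsq : sq' = !sq := by rw [h'.sq_eq, h.sq_eq]; cases o <;> cases β <;> rfl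
  have hsr : sr' = !sr := by rw [h'.sr_eq, h.sr_eq]; cases o <;> cases γ <;> rfl
  subst hsp hsq hsr
  have hn : ∀ v, v = p ∨ v = q ∨ v = r → ∀ a b,
      D'.side (D'.neighbor (φ v) a) b = ψ (D.side (D.neighbor v a) b) := by
    intro v hv a b
    rw [map_neighbor hnext]
    exact hside _ (h.neighbor_ne hv (.inl rfl) a) (h.neighbor_ne hv (.inr (.inl rfl)) a)
      (h.neighbor_ne hv (.inr (.inr rfl)) a) b
  have hp := hn p (.inl rfl)
  have hq := hn q (.inr (.inl rfl))
  have e₁ := h'.side_pX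
  have e₂ := h'.side_pX'
  have e₃ := h'.side_qX
  have e₄ := h'.side_pZ'
  have e₅ := h'.side_pZ
  have e₆ := h'.side_qY'
  rw [hp] at e₁ e₂ e₄ e₅
  rw [hq] at e₃ e₆
  rw [h.side_pZ'] at e₁
  rw [Bool.not_not, h.side_pZ] at e₂
  rw [h.side_qY'] at e₃
  rw [Bool.not_not, Bool.not_not, h.side_pX] at e₄
  rw [Bool.not_not, h.side_pX'] at e₅
  rw [Bool.not_not, Bool.not_not, h.side_qX] at e₆
  rw [← e₁, ← e₂, ← e₃, ← e₄, ← e₅, ← e₆] at h'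
  refine ⟨φ, ψ, p, q, r, α, β, γ, o, sp, sq, sr, T, Rp, Rq, Rr, RX, RY, RZ, hnext, h, h', ?_,
    hside, houter⟩
  intro v hv
  have h₁ := ne_of_not_isTriangleVertex hv (.inl rfl)
  have h₂ := ne_of_not_isTriangleVertex hv (.inr (.inl rfl))
  have h₃ := ne_of_not_isTriangleVertex hv (.inr (.inr rfl))
  exact hcr v h₁.1 h₁.2.1 h₂.1 h₂.2.1 h₃.1 h₃.2.1

namespace IsReidemeisterThree

variable {φ : D.V ≃ D'.V} {ψ : D.Region ≃ D'.Region} {p q r : D.V}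
  {α β γ o sp sq sr : Bool} {T Rp Rq Rr RX RY RZ : D.Region}

/-- The inverse of the move is again such a move, so extension and uniqueness are needed in one
direction only. -/
theorem symm (h : IsReidemeisterThree D D' φ ψ p q r α β γ o sp sq sr T Rp Rq Rr RX RY RZ) :
    IsReidemeisterThree D' D φ.symm ψ.symm (φ p) (φ q) (φ r) (!α) (!β) (!γ) o (!sp) (!sq) (!sr)
      (ψ T) (ψ RY) (ψ RZ) (ψ RX) (ψ Rr) (ψ Rp) (ψ Rq) where
  next v := by
    obtain ⟨v, rfl⟩ := φ.surjective v
    rw [← h.next, φ.symm_apply_apply, φ.symm_apply_apply]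
  before := h.after
  after := by
    simp only [Bool.not_not, Equiv.symm_apply_apply]
    exact h.before
  crossing v hv u b := by
    obtain ⟨v, rfl⟩ := φ.surjective v
    obtain ⟨u, rfl⟩ := φ.surjective u
    rw [isTriangleVertex_map φ h.next] at hv
    rw [φ.symm_apply_apply, φ.symm_apply_apply]
    exact (h.crossing v hv u b).symm
  side v hp hq hr b := by
    obtain ⟨v, rfl⟩ := φ.surjective v
    rw [φ.symm_apply_apply, h.side v (ne_of_apply_ne φ hp) (ne_of_apply_ne φ hq)
      (ne_of_apply_ne φ hr), ψ.symm_apply_apply]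
  outer := by rw [← h.outer, ψ.symm_apply_apply]

theorem isTriangleVertex_of_isCrossing
    (h : IsReidemeisterThree D D' φ ψ p q r α β γ o sp sq sr T Rp Rq Rr RX RY RZ) {x y : D.V}
    (hxy : D'.IsCrossing (φ x) (φ y)) :
    D.IsTriangleVertex p q r x ↔ D.IsTriangleVertex p q r y := by
  rw [← isTriangleVertex_map φ h.next, ← isTriangleVertex_map φ h.next]
  exact h.after.isTriangleVertex_iff hxy

/-- No crossing joins a corner vertex to another vertex, before or after the move, so control of the
over-vertices off the triangle suffices. -/
theorem exists_isCrossing_iff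
    (h : IsReidemeisterThree D D' φ ψ p q r α β γ o sp sq sr T Rp Rq Rr RX RY RZ) {v : D.V}
    (hv : ¬ D.IsTriangleVertex p q r v) :
    (∃ o, D'.IsCrossing o (φ v)) ↔ ∃ o, D.IsCrossing o v := by
  rw [φ.surjective.exists]
  refine exists_congr fun x => ?_
  by_cases hx : D.IsTriangleVertex p q r x
  · exact ⟨fun hc => (hv ((h.isTriangleVertex_of_isCrossing hc).1 hx)).elim,
      fun hc => (hv ((h.before.isTriangleVertex_iff hc).1 hx)).elim⟩
  · simp only [isCrossing_iff_exists_sign, h.crossing x hx]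

section Colorings

theorem apply_neighbor {X : Type*} {c : D.V → X} {c' : D'.V → X}
    (h : IsReidemeisterThree D D' φ ψ p q r α β γ o sp sq sr T Rp Rq Rr RX RY RZ)
    (hcc : ∀ v, v ≠ q → v ≠ r → c' (φ v) = c v) {v : D.V} (hv : v = p ∨ v = q ∨ v = r)
    (a : Bool) : c' (D'.neighbor (φ v) a) = c (D.neighbor v a) := by
  rw [map_neighbor h.next, hcc _ (h.before.neighbor_ne hv (.inr (.inl rfl)) a)
    (h.before.neighbor_ne hv (.inr (.inr rfl)) a)]

variable {X : Type*} [Quandle X] {c : D.V → X} {c' : D'.V → X}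

theorem isArcColoring
    (h : IsReidemeisterThree D D' φ ψ p q r α β γ o sp sq sr T Rp Rq Rr RX RY RZ)
    (hcc : ∀ v, v ≠ q → v ≠ r → c' (φ v) = c v) (hc : D.IsArcColoring c)
    (hq : c' (φ q) = c (D.neighbor q β))
    (hr : c' (φ r) = signedOp (!sp) (c (D.neighbor r γ)) (c p)) : D'.IsArcColoring c' := by
  have ht := h.before.triangleArcs hc
  have hp : c' (φ p) = c p := hcc p h.before.p_ne_q h.before.p_ne_r
  have np := fun a => h.apply_neighbor hcc (.inl rfl : p = p ∨ p = q ∨ p = r) a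
  have nq := fun a => h.apply_neighbor hcc (.inr (.inl rfl) : q = p ∨ q = q ∨ q = r) a
  have nr := fun a => h.apply_neighbor hcc (.inr (.inr rfl) : r = p ∨ r = q ∨ r = r) a
  have hcp : ∀ v, ¬ D.IsTriangleVertex p q r v → c' (φ v) = c v ∧
      c' (D'.prev (φ v)) = c (D.prev v) := by
    intro v hv
    have h₂ := ne_of_not_isTriangleVertex hv (.inr (.inl rfl))
    have h₃ := ne_of_not_isTriangleVertex hv (.inr (.inr rfl))
    rw [map_prev h.next]
    exact ⟨hcc v h₂.1 h₃.1, hcc _ h₂.2.2 h₃.2.2⟩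
  refine h.after.isArcColoring ⟨?_, ?_, ?_, ?_, ?_, ?_⟩ (fun v hv hu => ?_)
    (fun x u b hx hu hb => ?_)
  · rw [np, hp, ht.pZ]
  · rw [np, hp, Bool.not_not, ht.pX]
  · rw [nq, hq, Bool.not_not]
  · rw [nq, hq, ht.qY, hp, signedOp_eq_iff, Bool.not_not, ht.qX]
  -- The color of `φ r` was prescribed by the crossing with `p`; self-distributivity shows that the
  -- crossing with `q` gives the same color.
  · rw [nr, hq, hr, ← signedOp_eq_iff.1 ht.rZ, ← signedOp_eq_iff.1 ht.qX, ← signedOp_distrib,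
      signedOp_eq_iff.1 ht.rY]
  · rw [nr, hr, hp, Bool.not_not]
  · obtain ⟨v, rfl⟩ := φ.surjective v
    rw [isTriangleVertex_map φ h.next] at hv
    rw [(hcp v hv).1, (hcp v hv).2]
    exact hc.eq_of_not_under v (by rwa [← h.exists_isCrossing_iff hv])
  · obtain ⟨x, rfl⟩ := φ.surjective x
    obtain ⟨u, rfl⟩ := φ.surjective u
    rw [isTriangleVertex_map φ h.next] at hx hu
    rw [(hcp x hx).1, (hcp u hu).1, (hcp u hu).2]
    exact hc.crossing _ _ _ ((h.crossing x hx u b).1 hb)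

theorem apply_q_and_r
    (h : IsReidemeisterThree D D' φ ψ p q r α β γ o sp sq sr T Rp Rq Rr RX RY RZ)
    (hcc : ∀ v, v ≠ q → v ≠ r → c' (φ v) = c v) (hc' : D'.IsArcColoring c') :
    c' (φ q) = c (D.neighbor q β) ∧ c' (φ r) = signedOp (!sp) (c (D.neighbor r γ)) (c p) := by
  have ht := h.after.triangleArcs hc'
  have hp : c' (φ p) = c p := hcc p h.before.p_ne_q h.before.p_ne_r
  have hqY := ht.qY
  have hrZ := ht.rZ
  rw [h.apply_neighbor hcc (by simp), Bool.not_not] at hqY hrZ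
  rw [hp] at hrZ
  exact ⟨hqY.symm, hrZ.symm⟩

theorem arcColoring_unique
    (h : IsReidemeisterThree D D' φ ψ p q r α β γ o sp sq sr T Rp Rq Rr RX RY RZ)
    {c₁ c₂ : D'.V → X} (h₁ : D'.IsArcColoring c₁) (h₂ : D'.IsArcColoring c₂)
    (hc₁ : ∀ v, v ≠ q → v ≠ r → c₁ (φ v) = c v) (hc₂ : ∀ v, v ≠ q → v ≠ r → c₂ (φ v) = c v) :
    c₁ = c₂ := by
  funext v
  obtain ⟨v, rfl⟩ := φ.surjective v
  have e₁ := h.apply_q_and_r hc₁ h₁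
  have e₂ := h.apply_q_and_r hc₂ h₂
  by_cases hq : v = q
  · rw [hq, e₁.1, e₂.1]
  by_cases hr : v = r
  · rw [hr, e₁.2, e₂.2]
  rw [hc₁ v hq hr, hc₂ v hq hr]

variable {R : D.Region → X} {R' : D'.Region → X}

theorem ne_T (h : IsReidemeisterThree D D' φ ψ p q r α β γ o sp sq sr T Rp Rq Rr RX RY RZ) :
    RX ≠ T ∧ RY ≠ T ∧ RZ ≠ T ∧ Rp ≠ T ∧ Rq ≠ T ∧ Rr ≠ T := by
  have t := h.before
  have np := t.side_neighbor_ne (v := p) (.inl rfl)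
  have nq := t.side_neighbor_ne (v := q) (.inr (.inl rfl))
  exact ⟨t.side_pX' ▸ np _ _, t.side_qY' ▸ nq _ _, t.side_pZ' ▸ np _ _, t.side_qX ▸ nq _ _,
    t.side_pX ▸ np _ _, t.side_pZ ▸ np _ _⟩

/-- The new triangle receives its color across `p`. Entering it across `q` or `r` must give the same
color, and each agreement is one instance of self-distributivity. -/
theorem isRegionColoring
    (h : IsReidemeisterThree D D' φ ψ p q r α β γ o sp sq sr T Rp Rq Rr RX RY RZ)
    (hcc : ∀ v, v ≠ q → v ≠ r → c' (φ v) = c v) (hRR : ∀ x, x ≠ T → R' (ψ x) = R x)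
    (hc : D.IsArcColoring c) (hc' : D'.IsArcColoring c') (hR : D.IsRegionColoring c R)
    (hT : R' (ψ T) = signedOp (!sp) (R RY) (c p)) : D'.IsRegionColoring c' R' := by
  have t := h.before
  have t' := h.after
  obtain ⟨hX, hY, hZ, -, -, -⟩ := h.ne_T
  have ht := t.triangleArcs hc
  obtain ⟨eq, er⟩ := h.apply_q_and_r hcc hc'
  have ep : c' (φ p) = c p := hcc p t.p_ne_q t.p_ne_r
  have x₁ := hR (D.neighbor q (!β)) (!sq)
  rw [Bool.not_not, t.side_qY, t.side_qY', ht.qY] at x₁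
  have x₂ := hR (D.neighbor p (!α)) (!sp)
  rw [Bool.not_not, t.side_pZ, t.side_pZ', ht.pZ] at x₂
  have x₃ := hR (D.neighbor p α) (!sp)
  rw [Bool.not_not, t.side_pX, t.side_pX', ht.pX] at x₃
  have x₄ := hR (D.neighbor r γ) (!sr)
  rw [Bool.not_not, t.side_rY, t.side_rY'] at x₄
  classical
  refine isRegionColoring_of_side
    (fun v => if v = φ p then !sp else if v = φ q then !sq else !sr) fun v => ?_
  obtain ⟨v, rfl⟩ := φ.surjective v
  simp only [φ.injective.eq_iff]
  by_cases hp : v = p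
  · rw [if_pos hp, hp, t'.side_p, t'.side_p', hRR _ hY, hT, ep]
  rw [if_neg hp]
  by_cases hq : v = q
  · rw [if_pos hq, hq, t'.side_q, t'.side_q', hRR _ hZ, hT, eq, ← x₁, ← x₂,
      ← signedOp_eq_iff.1 ht.qX, ← signedOp_distrib]
  rw [if_neg hq]
  by_cases hr : v = r
  · rw [hr, t'.side_r, t'.side_r', hRR _ hX, hT, er, ← x₃, ← x₄, signedOp_distrib (!sp)]
  have hne := t.side_ne v hp hq hr
  rw [h.side v hp hq hr, h.side v hp hq hr, hRR _ (hne _), hRR _ (hne _), hcc v hq hr]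
  exact hR v _

theorem exists_shadowColoring
    (h : IsReidemeisterThree D D' φ ψ p q r α β γ o sp sq sr T Rp Rq Rr RX RY RZ) {a : X}
    (hs : D.IsShadowColoring a c R) : ∃ c' R', D'.IsShadowColoring a c' R' ∧
      (∀ v, v ≠ q → v ≠ r → c' (φ v) = c v) ∧ (∀ x, x ≠ T → R' (ψ x) = R x) := by
  classical
  let c₀ : D.V → X := Function.update (Function.update c q (c (D.neighbor q β)))
    r (signedOp (!sp) (c (D.neighbor r γ)) (c p))
  let R₀ : D.Region → X := Function.update R T (signedOp (!sp) (R RY) (c p))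
  have hcc : ∀ v, v ≠ q → v ≠ r → (c₀ ∘ φ.symm) (φ v) = c v := by
    intro v hq hr
    simp [c₀, hq, hr]
  have hRR : ∀ x, x ≠ T → (R₀ ∘ ψ.symm) (ψ x) = R x := by
    intro x hx
    simp [R₀, hx]
  have hc' : D'.IsArcColoring (c₀ ∘ φ.symm) :=
    h.isArcColoring hcc hs.arc (by simp [c₀, h.before.q_ne_r]) (by simp [c₀])
  refine ⟨c₀ ∘ φ.symm, R₀ ∘ ψ.symm, ⟨hc', ?_, ?_⟩, hcc, hRR⟩
  · exact h.isRegionColoring hcc hRR hs.arc hc' hs.region (by simp [R₀])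
  · rw [← h.outer, hRR _ h.before.ne_outer.symm]
    exact hs.outer

theorem regionColoring_unique
    (h : IsReidemeisterThree D D' φ ψ p q r α β γ o sp sq sr T Rp Rq Rr RX RY RZ)
    {R₁ R₂ : D'.Region → X} (h₁ : D'.IsRegionColoring c' R₁) (h₂ : D'.IsRegionColoring c' R₂)
    (hR₁ : ∀ x, x ≠ T → R₁ (ψ x) = R x) (hR₂ : ∀ x, x ≠ T → R₂ (ψ x) = R x) : R₁ = R₂ := by
  funext x
  obtain ⟨x, rfl⟩ := ψ.surjective x
  by_cases hx : x = T
  · have e₁ := h₁ (φ p) (!sp)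
    have e₂ := h₂ (φ p) (!sp)
    rw [h.after.side_p, h.after.side_p', hR₁ _ h.ne_T.2.1] at e₁
    rw [h.after.side_p, h.after.side_p', hR₂ _ h.ne_T.2.1] at e₂
    rw [hx, ← e₁, ← e₂]
  · rw [hR₁ x hx, hR₂ x hx]

theorem finsum_localWeight_eq {A : Type*} [AddCommGroup A] {θ : X → X → X → A}
    (hθ : IsQuandleThreeCocycle θ)
    (h : IsReidemeisterThree D D' φ ψ p q r α β γ o sp sq sr T Rp Rq Rr RX RY RZ) {a : X}
    (hs : D.IsShadowColoring a c R) (hs' : D'.IsShadowColoring a c' R')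
    (hcc : ∀ v, v ≠ q → v ≠ r → c' (φ v) = c v) (hRR : ∀ x, x ≠ T → R' (ψ x) = R x) :
    ∑ᶠ x ∈ D.signedCrossings, D.localWeight θ c R x =
      ∑ᶠ x ∈ D'.signedCrossings, D'.localWeight θ c' R' x := by
  have t := h.before
  have t' := h.after
  have ht := t.triangleArcs hs.arc
  have ht' := t'.triangleArcs hs'.arc
  obtain ⟨hX, hY, hZ, hp, hq, hr⟩ := h.ne_T
  have ep : c' (φ p) = c p := hcc p t.p_ne_q t.p_ne_r
  have eq := (h.apply_q_and_r hcc hs'.arc).1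
  have nq := fun a => h.apply_neighbor hcc (.inr (.inl rfl) : q = p ∨ q = q ∨ q = r) a
  have nr := fun a => h.apply_neighbor hcc (.inr (.inr rfl) : r = p ∨ r = q ∨ r = r) a
  rw [t.finsum_localWeight ht, t'.finsum_localWeight ht']
  congr 1
  · rw [hRR _ hX, hRR _ hY, hRR _ hZ, hRR _ hp, hRR _ hq, hRR _ hr, ep, eq, nq, nr, nr,
      Bool.not_not, ht.qY]
    have hR := hs.region
    have hR' := hs'.region
    refine triangleWeight_eq hθ o sp sq sr ?_ ?_ ?_ ?_ ?_ ?_ ?_ ?_ ?_ ?_ ?_ ?_ ht.qX ht.rY ht.rZ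
      ?_ ?_
    · rw [← t.side_p, ← t.side_p']; exact hR _ _
    · rw [← t.side_pX, ← t.side_pX', ← ht.pX]; exact hR _ _
    · rw [← t.side_pZ, ← t.side_pZ', ← ht.pZ]; exact hR _ _
    · rw [← hRR _ hY, ← t'.side_p, ← t'.side_p', ← ep]; exact hR' _ _
    · rw [← t.side_q, ← t.side_q']; exact hR _ _
    · rw [← t.side_qY, ← t.side_qY', ← ht.qY]; exact hR _ _
    · rw [← t.side_qX, ← t.side_qX']; exact hR _ _
    · rw [← hRR _ hZ, ← t'.side_q, ← t'.side_q', ← eq]; exact hR' _ _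
    · rw [← t.side_r, ← t.side_r']; exact hR _ _
    · rw [← t.side_rY, ← t.side_rY']; exact hR _ _
    · rw [← t.side_rZ, ← t.side_rZ']; exact hR _ _
    · rw [← hRR _ hX, ← t'.side_r, ← t'.side_r']; exact hR' _ _
    · have := ht'.rY
      rwa [nr, eq] at this
    · have := ht'.rZ
      rwa [nr, ep, Bool.not_not] at this
  · have hset : {x | x ∈ D'.signedCrossings ∧ ¬ D'.IsTriangleVertex (φ p) (φ q) (φ r) x.1} =
        mapCrossing φ '' {x | x ∈ D.signedCrossings ∧ ¬ D.IsTriangleVertex p q r x.1} := by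
      ext ⟨x, u, b⟩
      obtain ⟨x, rfl⟩ := φ.surjective x
      obtain ⟨u, rfl⟩ := φ.surjective u
      rw [show (φ x, φ u, b) = mapCrossing φ (x, u, b) from rfl,
        (mapCrossing_injective φ.injective).mem_set_image]
      change D'.IsSignedCrossing (φ x) (φ u) b ∧ ¬ D'.IsTriangleVertex (φ p) (φ q) (φ r) (φ x) ↔
        D.IsSignedCrossing x u b ∧ ¬ D.IsTriangleVertex p q r x
      rw [isTriangleVertex_map φ h.next]
      exact and_congr_left fun hx => h.crossing x hx u b
    rw [hset, finsum_localWeight_image φ.injective]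
    rintro x u b ⟨hb, hx⟩
    have hb' : D.IsSignedCrossing x u b := hb
    have hu := (t.isTriangleVertex_iff hb'.1).not.1 hx
    have x₂ := ne_of_not_isTriangleVertex hx (.inr (.inl rfl))
    have x₃ := ne_of_not_isTriangleVertex hx (.inr (.inr rfl))
    have h₁ := ne_of_not_isTriangleVertex hu (.inl rfl)
    have h₂ := ne_of_not_isTriangleVertex hu (.inr (.inl rfl))
    have h₃ := ne_of_not_isTriangleVertex hu (.inr (.inr rfl))
    refine localWeight_eq (hcc x x₂.1 x₃.1) (hcc u h₂.1 h₃.1) ?_ ?_ ?_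
    · rw [map_prev h.next, hcc _ h₂.2.2 h₃.2.2]
    · rw [h.side u h₁.1 h₂.1 h₃.1, hRR _ (t.side_ne u h₁.1 h₂.1 h₃.1 _)]
    · rw [map_prev h.next, h.side _ h₁.2.2 h₂.2.2 h₃.2.2,
        hRR _ (t.side_ne _ h₁.2.2 h₂.2.2 h₃.2.2 _)]

end Colorings

end IsReidemeisterThree

theorem ReidemeisterThree.shadowEquivalent {X A : Type*} [Quandle X] [AddCommGroup A] {a : X}
    {θ : X → X → X → A} (hθ : IsQuandleThreeCocycle θ) (h : ReidemeisterThree D D') :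
    ShadowEquivalent a θ D D' := by
  obtain ⟨φ, ψ, p, q, r, α, β, γ, o, sp, sq, sr, T, Rp, Rq, Rr, RX, RY, RZ, h⟩ := h.exists_data
  -- Being related is symmetric under passing to the inverse move, which allows `h.symm` to supply
  -- the converse statements.
  have hP : ∀ {c : D.V → X} {c' : D'.V → X}, (∀ v, v ≠ q → v ≠ r → c' (φ v) = c v) ↔
      ∀ v, v ≠ φ q → v ≠ φ r → c (φ.symm v) = c' v := by
    intro c c'
    rw [φ.surjective.forall]
    simp only [ne_eq, φ.injective.eq_iff, φ.symm_apply_apply, eq_comm]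
  have hQ : ∀ {R : D.Region → X} {R' : D'.Region → X}, (∀ x, x ≠ T → R' (ψ x) = R x) ↔
      ∀ x, x ≠ ψ T → R (ψ.symm x) = R' x := by
    intro R R'
    rw [ψ.surjective.forall]
    simp only [ne_eq, ψ.injective.eq_iff, ψ.symm_apply_apply, eq_comm]
  refine .of_relations (fun c c' => ∀ v, v ≠ q → v ≠ r → c' (φ v) = c v)
    (fun R R' => ∀ x, x ≠ T → R' (ψ x) = R x)
    (fun c R hs => h.exists_shadowColoring hs) (fun c R hs => ?_)
    (fun f c c' hc v hq hr => congrArg f (hc v hq hr))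
    (fun c c₁ c₂ h₁ h₂ hc₁ hc₂ => h.arcColoring_unique h₁ h₂ hc₁ hc₂)
    (fun c c₁ c₂ h₁ h₂ hc₁ hc₂ => h.symm.arcColoring_unique h₁ h₂ (hP.1 hc₁) (hP.1 hc₂))
    (fun c R R₁ R₂ h₁ h₂ hR₁ hR₂ => h.regionColoring_unique h₁ h₂ hR₁ hR₂)
    (fun c R R₁ R₂ h₁ h₂ hR₁ hR₂ => h.symm.regionColoring_unique h₁ h₂ (hQ.1 hR₁) (hQ.1 hR₂))
    (fun c R c' R' hs hs' hc hR => h.finsum_localWeight_eq hθ hs hs' hc hR)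
  obtain ⟨c', R', h', hc, hR⟩ := h.symm.exists_shadowColoring hs
  exact ⟨c', R', h', hP.2 hc, hQ.2 hR⟩

end ReidemeisterThree

theorem RelatedByReidemeisterMoves.shadowEquivalent {D D' : LinkDiagram}
    (h : D.RelatedByReidemeisterMoves D') {X A : Type*} [Quandle X] [AddCommGroup A] {a : X}
    {θ : X → X → X → A} (hθ : IsQuandleThreeCocycle θ) : ShadowEquivalent a θ D D' := by
  induction h with
  | rel D D' h =>
    cases h with
    | isotopy h => exact h.shadowEquivalent
    | subdivision h => exact h.shadowEquivalent
    | one h => exact h.shadowEquivalent hθ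
    | two h => exact h.shadowEquivalent
    | three h => exact h.shadowEquivalent hθ
  | refl D => exact .refl D
  | symm D D' _ ih => exact ih.symm
  | trans D D' D'' _ _ ih ih' => exact ih.trans ih'

end LinkDiagram

theorem mainTheorem7 (D D' : LinkDiagram) (hD : D.RelatedByReidemeisterMoves D')
    {X : Type*} [Quandle X] [Finite X] (a : X) (S : Set (ShelfHom X X))
    {A : Type*} [AddCommGroup A] (θ : X → X → X → A) (hθ : IsQuandleThreeCocycle θ) :
    Nonempty (WeightedQuiverIso
      (ShadowQuiver.rho θ : ShadowQuiver D S a → A)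
      (ShadowQuiver.rho θ : ShadowQuiver D' S a → A)) :=
  (hD.shadowEquivalent hθ).nonempty_weightedQuiverIso S
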